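/- **Setting.** Let $\mathcal S$ be a finite nonempty state space with an involution $x\mapsto x^*$, let $\beta>0$, and let $c(x,y)\ge 0$ ($x\ne y$) be a connectivity function such that any state can be reached from any other through jumps with $c\neq 0$. Let $E,K$ be real constants. The data $(\mathcal S,*,\beta,c,E,K)$ fix a class of models. A model of the class consists of, for parameters $\nu,\kappa$ in arbitrary parameter sets: * a Hamiltonian $H^\nu_x\in\mathbb R$ with $|H^\nu_x|\le E$ and $H^\nu_{x^*}=H^\nu_x$; * equilibrium rates $R^{(\beta,\nu)}_{x\to y}$ ($x\neq y$) with $e^{-K}c(x,y)\le R^{(\beta,\nu)}_{x\to y}\le e^{K}c(x,y)$ which satisfy $e^{-\beta H^\nu_x}R^{(\beta,\nu)}_{x\to y}=e^{-\beta H^\nu_{y^*}}R^{(\beta,\nu)}_{y^*\to x^*}$ and whose escape rates $\lambda_x=\sum_{y\ne x}R_{x\to y}$ satisfy $\lambda_x=\lambda_{x^*}$ (the standard choices $c(x,y)e^{\beta H^\nu_x}$ and $c(x,y)e^{(\beta/2)(H^\nu_x-H^\nu_y)}$ obey the bounds with $K=\beta E$); * a function $\xi^\kappa_{x\to y}$ with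 $|\xi^\kappa_{x\to y}|\le 1$ whenever $c(x,y)\ne0$. For $\alpha=(\beta,\varepsilon,\nu,\kappa)$ with $\varepsilon\ge0$ put $R^\alpha_{x\to y}=e^{\varepsilon\xi^\kappa_{x\to y}}R^{(\beta,\nu)}_{x\to y}$, and consider those $\alpha$ for which the escape rates satisfy $\lambda^\alpha_x=\lambda^\alpha_{x^*}$ for all $x$. Let $$\psi^\alpha_{x\to y}=\log\frac{R^\alpha_{x\to y}}{R^\alpha_{y^*\to x^*}}-\beta(H^\nu_x-H^\nu_y),\qquad \Psi=\sum_{j=1}^n\psi^\alpha_{x_{j-1}\to x_j}$$ for a path with $n$ jumps through the states $x_0,\dots,x_n$. For the Markov jump process with constant rates $R^\alpha$, let $\langle f\rangle^{[a,b]}_{x\to}$ be the expectation of $f$ over paths on $[a,b]$ started at $x$, and let $[f]^{[a,b]}_{\mathrm{st}\to y}$ be the expectation of $f$ times the indicator that the path ends at $y$, with the initial state drawn from the stationary distribution $\rho^\alpha$. **Theorem.** There is a constant $A'>0$ depending only on the class $(\mathcal S,*,\beta,c,E,K)$ such that, for every model of the class and every such $\varepsilon,\nu,\kappa$, the following holds.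 There is a unique stationary probability distribution $\rho^\alpha$, and $\rho^\alpha_x>0$ for all $x$. The free energy $F(\alpha)$ given by $$e^{-\beta F(\alpha)}=e^{-\beta H^\nu_x}\lim_{\tau\to\infty}\frac{\langle e^{-\Psi/2}\rangle^{[-\tau,-\tau/2]}_{x\to}}{[e^{-\Psi/2}]^{[\tau/2,\tau]}_{\mathrm{st}\to x^*}}$$ is well defined: the limit exists, is positive, and the right-hand side does not depend on $x$. With $S(\alpha)=\beta\bigl(\sum_x H^\nu_x\rho^\alpha_x-F(\alpha)\bigr)$ and $S_{\mathrm{sym}}[p]=-\sum_x p_x\log\sqrt{p_xp_{x^*}}$, $$\bigl|S(\alpha)-S_{\mathrm{sym}}[\rho^\alpha]\bigr|\le A'\varepsilon^3 .$$ -/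

import Mathlib

namespace NESS

/-! ### Markov jump processes on a finite state space

A family of transition rates is a function `R : S → S → ℝ`, where `R x y` is the rate of the jump
`x → y`; the diagonal values `R x x` are never used. -/

section Rates

variable {S : Type*} [Fintype S] [DecidableEq S]

/-- The escape rate `λ_x = ∑_{y ≠ x} R_{x → y}`. -/
def escapeRate (R : S → S → ℝ) (x : S) : ℝ :=
  ∑ y ∈ Finset.univ.erase x, R x y

/-- `p` is a probability distribution that is stationary for the master equation
`dp_x/dt = - λ_x p_x + ∑_{y ≠ x} p_y R_{y → x}`. -/
structure IsStationary (R : S → S → ℝ) (p : S → ℝ) : Prop where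
  nonneg : ∀ x, 0 ≤ p x
  sum_eq_one : ∑ x, p x = 1
  stationary : ∀ x, -escapeRate R x * p x + ∑ y ∈ Finset.univ.erase x, p y * R y x = 0

/-- Any two states are joined by a chain of jumps along which `c` does not vanish. -/
def IsConnected (c : S → S → ℝ) : Prop :=
  ∀ x y, Relation.ReflTransGen (fun a b => a ≠ b ∧ c a b ≠ 0) x y

end Rates

/-! ### Paths and path integrals -/

/-- A path `(n, (x_0, …, x_n), (t_1, …, t_n))`: the number of jumps, the visited states and the
jump times. -/
structure JumpPath (S : Type*) where
  n : ℕ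
  state : Fin (n + 1) → S
  time : Fin n → ℝ

namespace JumpPath

variable {S : Type*}

/-- The initial state `x_0`. -/
def first (w : JumpPath S) : S := w.state 0

/-- The final state `x_n`. -/
def last (w : JumpPath S) : S := w.state (Fin.last w.n)

/-- The sum of `g x_{j-1} x_j` over all jumps `j = 1, …, n` of the path. -/
def sumJumps (g : S → S → ℝ) (w : JumpPath S) : ℝ :=
  ∑ j : Fin w.n, g (w.state j.castSucc) (w.state j.succ)

/-- `t_{j+1} - t_j`, the time spent in `x_j`, with `t_0 = a` and `t_{n+1} = b`. -/
def holdingTime (a b : ℝ) (w : JumpPath S) (j : Fin (w.n + 1)) : ℝ :=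
  (Fin.snoc w.time b : Fin (w.n + 1) → ℝ) j - (Fin.cons a w.time : Fin (w.n + 1) → ℝ) j

/-- The weight of a path on the time interval `[a, b]` for time-independent rates `R`:
`∏_{j=1}^n R_{x_{j-1} → x_j} · ∏_{j=0}^n exp(- λ_{x_j} (t_{j+1} - t_j))`. -/
noncomputable def weight [Fintype S] [DecidableEq S] (R : S → S → ℝ) (a b : ℝ)
    (w : JumpPath S) : ℝ :=
  (∏ j : Fin w.n, R (w.state j.castSucc) (w.state j.succ)) *
    ∏ j : Fin (w.n + 1), Real.exp (-(escapeRate R (w.state j) * w.holdingTime a b j))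

end JumpPath

section Expectations

variable {S : Type*} [Fintype S] [DecidableEq S]

/-- Ordered jump times `a < t_1 < … < t_n < b`. -/
def orderedTimes (a b : ℝ) (n : ℕ) : Set (Fin n → ℝ) :=
  {t | StrictMono t ∧ ∀ j, a < t j ∧ t j < b}

/-- The integral over all paths on `[a, b]`: the sum over `n` and over `x_0, …, x_n` with
`x_{j-1} ≠ x_j` of the integral over `a < t_1 < … < t_n < b`. -/
noncomputable def pathIntegral (a b : ℝ) (f : JumpPath S → ℝ) : ℝ :=
  ∑' n : ℕ, ∑ x : Fin (n + 1) → S,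
    if ∀ j : Fin n, x j.castSucc ≠ x j.succ then
      ∫ t in orderedTimes a b n, f ⟨n, x, t⟩
    else 0

/-- `⟨f⟩_{x →}` on `[a, b]` for constant rates `R`: the expectation of `f` over paths that start
at `x`. -/
noncomputable def expFrom (R : S → S → ℝ) (a b : ℝ) (x : S) (f : JumpPath S → ℝ) : ℝ :=
  pathIntegral a b fun w => if w.first = x then f w * w.weight R a b else 0

/-- `[f]_{st → y}` on `[a, b]` for constant rates `R`: the unnormalized expectation of `f` over
paths whose initial state has distribution `p` and whose final state is `y`. -/
noncomputable def expTo (R : S → S → ℝ) (p : S → ℝ) (a b : ℝ) (y : S)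
    (f : JumpPath S → ℝ) : ℝ :=
  pathIntegral a b fun w => if w.last = y then f w * (p w.first * w.weight R a b) else 0

end Expectations

/-! ### Entropy production, free energy and entropy with a time-reversal involution `star` -/

section Thermodynamics

variable {S : Type*}

/-- The entropy production in the baths, `θ_{x → y} = log (R_{x → y} / R_{y* → x*})`. -/
noncomputable def entropyProd (star : S → S) (R : S → S → ℝ) (x y : S) : ℝ :=
  Real.log (R x y / R (star y) (star x))

/-- The nonequilibrium part `ψ_{x → y} = θ_{x → y} - β (H_x - H_y)`. -/
noncomputable def neqEntropyProd (star : S → S) (β : ℝ) (H : S → ℝ) (R : S → S → ℝ)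
    (x y : S) : ℝ :=
  entropyProd star R x y - β * (H x - H y)

/-- The path functional `exp (- Ψ / 2)`, where `Ψ = ∑_j ψ_{x_{j-1} → x_j}` is the nonequilibrium
part of the total entropy production. -/
noncomputable def expNegHalfPsi (star : S → S) (β : ℝ) (H : S → ℝ) (R : S → S → ℝ)
    (w : JumpPath S) : ℝ :=
  Real.exp (-(w.sumJumps (neqEntropyProd star β H R)) / 2)

variable [Fintype S] [DecidableEq S]

/-- `F` is the free energy of the model with energy `H`, constant rates `R` and stationary
distribution `ρ`: for every state `x`,
`exp (-β F) = exp (-β H_x) lim_{τ → ∞} ⟨exp (-Ψ/2)⟩_{x →} / [exp (-Ψ/2)]_{st → x*}`, with the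
numerator taken on `[-τ, -τ/2]` and the denominator on `[τ/2, τ]`. -/
def IsFreeEnergy (star : S → S) (β : ℝ) (H : S → ℝ) (R : S → S → ℝ) (ρ : S → ℝ) (F : ℝ) :
    Prop :=
  ∀ x, Filter.Tendsto
    (fun τ : ℝ => Real.exp (-β * H x) *
      (expFrom R (-τ) (-τ / 2) x (expNegHalfPsi star β H R) /
        expTo R ρ (τ / 2) τ (star x) (expNegHalfPsi star β H R)))
    Filter.atTop (nhds (Real.exp (-β * F)))

/-- The nonequilibrium entropy `β (⟨H⟩_st - F)`. -/
def entropy (β : ℝ) (H : S → ℝ) (ρ : S → ℝ) (F : ℝ) : ℝ :=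
  β * (∑ x, H x * ρ x - F)

/-- The symmetrized Shannon entropy `- ∑_x p_x log √(p_x p_{x*})`. -/
noncomputable def symEntropy (star : S → S) (p : S → ℝ) : ℝ :=
  -∑ x, p x * Real.log (Real.sqrt (p x * p (star x)))

end Thermodynamics

/-! ### The class of models -/

/-- Models with momenta. The class is fixed by the state space `S`, the time reversal `star`, the
reference inverse temperature `β`, the connectivity function `c` and the constants `E` and `K`.
A member consists of a time-reversal symmetric Hamiltonian bounded by `E`, rates of an equilibrium
dynamics, and a nonequilibrium function bounded by `1`, which depend on parameters `ν : N` and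
`κ : P` ranging over arbitrary sets.

The equilibrium rates are comparable with `c`. For the standard choices `c x y * exp (β * H x)`
and `c x y * exp (β / 2 * (H x - H y))` the bounds `rateEq_lower` and `rateEq_upper` hold with
`K = β * E`. -/
structure Model {S : Type*} [Fintype S] [DecidableEq S] (star : S → S) (β : ℝ)
    (c : S → S → ℝ) (E K : ℝ) (N P : Type*) where
  /-- the Hamiltonian `H^ν_x` -/
  H : N → S → ℝ
  /-- the equilibrium rates `R^{(β,ν)}_{x → y}` -/
  rateEq : N → S → S → ℝ
  /-- the nonequilibrium function `ξ^κ_{x → y}` -/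
  xi : P → S → S → ℝ
  H_bound : ∀ ν x, |H ν x| ≤ E
  H_star : ∀ ν x, H ν (star x) = H ν x
  rateEq_lower : ∀ ν x y, x ≠ y → Real.exp (-K) * c x y ≤ rateEq ν x y
  rateEq_upper : ∀ ν x y, x ≠ y → rateEq ν x y ≤ Real.exp K * c x y
  detailed_balance : ∀ ν x y, x ≠ y →
    Real.exp (-β * H ν x) * rateEq ν x y =
      Real.exp (-β * H ν (star y)) * rateEq ν (star y) (star x)
  escapeRate_star : ∀ ν x, escapeRate (rateEq ν) (star x) = escapeRate (rateEq ν) x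
  xi_bound : ∀ κ x y, x ≠ y → c x y ≠ 0 → |xi κ x y| ≤ 1

/-- The transition rates `R^α_{x → y} = exp (ε ξ^κ_{x → y}) R^{(β,ν)}_{x → y}` for
`α = (β, ε, ν, κ)`. -/
noncomputable def Model.rate {S : Type*} [Fintype S] [DecidableEq S] {star : S → S} {β : ℝ}
    {c : S → S → ℝ} {E K : ℝ} {N P : Type*} (M : Model star β c E K N P)
    (ε : ℝ) (ν : N) (κ : P) (x y : S) : ℝ :=
  Real.exp (ε * M.xi κ x y) * M.rateEq ν x y

end NESS

/-! Write λ for the escape rates and w = exp(-βH). Under the weight exp(-Ψ/2) the holding factors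
stay as they are, while detailed balance turns the rates R = exp(ε ξ(x,y)) R_eq(x,y) into T, the
geometric mean of R and Q(x,y) = exp(ε ξ(y*,x*)) R_eq(x,y). Path integrals are Duhamel series
(`pathIntegral_eq`), so both expectations solve V' = (T - λ)V, and their large-time behaviour is set
by the Perron data of T - λ: an eigenvalue Λ, a right eigenvector r > 0 and a left one
(`exists_pos_eigenvector`, `tendsto_flow`). Since w_x T(x,y) = w_y T(y*,x*) and λ is invariant under
the involution, the left eigenvector is w_x r(x*). The exponential factors cancel in the quotient
and exp(-βF) = ∑ w r / ∑ ρ r, for every x.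

Let p = w / ∑ w be the Gibbs distribution and h(x) = ρ(x*) / p(x). The two entropies then differ by
`entropyGap`, which involves only p, h and r. The constant 1 satisfies R1 = λ1, stationarity of ρ
reads Qh = λh, and Tr = (λ + Λ)r. Because T = (R + Q)/2 + O(ε²), the function 1 + (h - 1)/2 is an
approximate eigenvector, which forces Λ = O(ε²) and r - 1 = (h - 1)/2 + O(ε²)
(`exists_perturbation_bound`). With a = h - 1 and b = r - 1, both of p-mean zero, the gap is -∑ p
a(x*) b + ½ ∑ p a(x*) a + O(ε³), and the two quadratic terms cancel to order ε³
(`abs_entropyGap_le`).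

For ε bounded away from 0, Harnack bounds make log h and log r, hence the gap, grow at most linearly
in ε, which ε³ dominates. All constants come from connectedness, the size of c and K, so they are
uniform in the model. -/

namespace NESS

open MeasureTheory Finset

/-! ### Path integrals as Duhamel series of a linear evolution equation -/

section PathExpansion

variable {S : Type*}

/-- The integral over the ordered jump times in `(a, b)` of the product of the holding factors
`exp (-lam (x j) * (t_{j+1} - t_j))`, organised as an iterated integral. -/
noncomputable def holdingIntegral (lam : S → ℝ) (b : ℝ) :
    (n : ℕ) → (Fin (n + 1) → S) → ℝ → ℝ
  | 0, x, a => Real.exp (-(lam (x 0) * (b - a)))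
  | n + 1, x, a =>
      ∫ s in a..b, Real.exp (-(lam (x 0) * (s - a))) * holdingIntegral lam b n (Fin.tail x) s

theorem continuous_holdingIntegral (lam : S → ℝ) (b : ℝ) (n : ℕ) (x : Fin (n + 1) → S) :
    Continuous (holdingIntegral lam b n x) := by
  induction n with
  | zero =>
    have : holdingIntegral lam b 0 x = fun a => Real.exp (-(lam (x 0) * (b - a))) := rfl
    rw [this]
    fun_prop
  | succ n ih =>
    have h := ih (Fin.tail x)
    have : holdingIntegral lam b (n + 1) x = fun a => -∫ s in b..a,
        Real.exp (-(lam (x 0) * (s - a))) * holdingIntegral lam b n (Fin.tail x) s := by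
      funext a
      rw [holdingIntegral, intervalIntegral.integral_symm]
    rw [this]
    refine Continuous.neg ?_
    exact intervalIntegral.continuous_parametric_intervalIntegral_of_continuous
      (f := fun a s => Real.exp (-(lam (x 0) * (s - a))) * holdingIntegral lam b n (Fin.tail x) s)
      (by unfold Function.uncurry; fun_prop) continuous_id

theorem measurableSet_orderedTimes (a b : ℝ) (n : ℕ) : MeasurableSet (orderedTimes a b n) := by
  have : orderedTimes a b n =
      (⋂ i, ⋂ j, ⋂ _ : i < j, {t : Fin n → ℝ | t i < t j}) ∩
        ⋂ j, ({t : Fin n → ℝ | a < t j} ∩ {t | t j < b}) := by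
    ext t
    simp only [orderedTimes, StrictMono, Set.mem_ofPred_eq, Set.mem_inter_iff, Set.mem_iInter]
  rw [this]
  refine MeasurableSet.inter ?_ ?_
  · refine MeasurableSet.iInter fun i => MeasurableSet.iInter fun j => MeasurableSet.iInter fun _ =>
      measurableSet_lt (measurable_pi_apply i) (measurable_pi_apply j)
  · exact MeasurableSet.iInter fun j => (measurableSet_lt measurable_const
      (measurable_pi_apply j)).inter (measurableSet_lt (measurable_pi_apply j) measurable_const)

theorem cons_mem_orderedTimes {a b s : ℝ} {n : ℕ} {t : Fin n → ℝ} :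
    (Fin.cons s t : Fin (n + 1) → ℝ) ∈ orderedTimes a b (n + 1) ↔
      s ∈ Set.Ioo a b ∧ t ∈ orderedTimes s b n := by
  simp only [orderedTimes, Set.mem_ofPred_eq, Set.mem_Ioo, Fin.forall_fin_succ, Fin.cons_zero,
    Fin.cons_succ]
  constructor
  · rintro ⟨hm, hs, ht⟩
    refine ⟨hs, fun i j hij => ?_, fun j => ⟨?_, (ht j).2⟩⟩
    · simpa using hm (Fin.succ_lt_succ_iff.2 hij)
    · simpa using hm (Fin.succ_pos j)
  · rintro ⟨hs, hm, ht⟩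
    refine ⟨?_, hs, fun j => ⟨hs.1.trans (ht j).1, (ht j).2⟩⟩
    intro i j hij
    induction i using Fin.cases with
    | zero =>
      induction j using Fin.cases with
      | zero => exact absurd hij (lt_irrefl _)
      | succ j => simpa using (ht j).1
    | succ i =>
      induction j using Fin.cases with
      | zero => exact absurd hij (Fin.not_lt_zero _)
      | succ j => simpa using hm (Fin.succ_lt_succ_iff.1 hij)

theorem continuous_holdingTime (a b : ℝ) {n : ℕ} (x : Fin (n + 1) → S) (j : Fin (n + 1)) :
    Continuous fun t : Fin n → ℝ => (⟨n, x, t⟩ : JumpPath S).holdingTime a b j := by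
  unfold JumpPath.holdingTime
  have h1 : Continuous fun t : Fin n → ℝ => (Fin.snoc t b : Fin (n + 1) → ℝ) :=
    Continuous.finSnoc (A := fun _ => ℝ) continuous_id continuous_const
  have h2 : Continuous fun t : Fin n → ℝ => (Fin.cons a t : Fin (n + 1) → ℝ) :=
    Continuous.finCons (A := fun _ => ℝ) continuous_const continuous_id
  exact ((continuous_apply j).comp h1).sub ((continuous_apply j).comp h2)

theorem holdingTime_cons_zero (a b s : ℝ) {n : ℕ} (x : Fin (n + 2) → S) (t : Fin n → ℝ) :
    (⟨n + 1, x, Fin.cons s t⟩ : JumpPath S).holdingTime a b 0 = s - a := by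
  simp only [JumpPath.holdingTime]
  rw [← Fin.cons_snoc_eq_snoc_cons]
  simp

theorem holdingTime_cons_succ (a b s : ℝ) {n : ℕ} (x : Fin (n + 2) → S) (t : Fin n → ℝ)
    (j : Fin (n + 1)) :
    (⟨n + 1, x, Fin.cons s t⟩ : JumpPath S).holdingTime a b j.succ =
      (⟨n, Fin.tail x, t⟩ : JumpPath S).holdingTime s b j := by
  simp only [JumpPath.holdingTime]
  rw [← Fin.cons_snoc_eq_snoc_cons]
  simp

theorem integrableOn_orderedTimes {a b : ℝ} {n : ℕ} {f : (Fin n → ℝ) → ℝ} (hf : Continuous f) :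
    IntegrableOn f (orderedTimes a b n) := by
  have hc : IsCompact (Set.Icc (fun _ : Fin n => a) (fun _ => b)) := isCompact_Icc
  refine (hf.continuousOn.integrableOn_compact hc).mono_set ?_
  intro t ht
  exact ⟨fun j => (ht.2 j).1.le, fun j => (ht.2 j).2.le⟩

/-- Fubini: over a first jump time s, the fibre of the simplex is the simplex of the remaining times
in (s, b). -/
theorem setIntegral_orderedTimes_succ {a b : ℝ} {n : ℕ} {f : (Fin (n + 1) → ℝ) → ℝ}
    (hf : Continuous f) :
    ∫ t in orderedTimes a b (n + 1), f t =
      ∫ s in Set.Ioo a b, ∫ t in orderedTimes s b n, f (Fin.cons s t) := by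
  have hmp := (volume_preserving_piFinSuccAbove (fun _ : Fin (n + 1) => ℝ) 0).symm
  have hint : Integrable ((orderedTimes a b (n + 1)).indicator f) :=
    (integrable_indicator_iff (measurableSet_orderedTimes a b (n + 1))).2
      (integrableOn_orderedTimes hf)
  have hval : ∀ p : ℝ × (Fin n → ℝ),
      (MeasurableEquiv.piFinSuccAbove (fun _ : Fin (n + 1) => ℝ) 0).symm p = Fin.cons p.1 p.2 := by
    intro p
    simp [MeasurableEquiv.piFinSuccAbove, Fin.insertNthEquiv]
  rw [← integral_indicator (measurableSet_orderedTimes a b (n + 1)),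
    ← hmp.integral_comp' , Measure.volume_eq_prod, integral_prod,
    ← integral_indicator measurableSet_Ioo]
  · refine integral_congr_ae (Filter.Eventually.of_forall fun s => ?_)
    by_cases hs : s ∈ Set.Ioo a b
    · simp only [Set.indicator_of_mem hs]
      rw [← integral_indicator (measurableSet_orderedTimes s b n)]
      refine integral_congr_ae (Filter.Eventually.of_forall fun t => ?_)
      simp only [hval]
      by_cases ht : t ∈ orderedTimes s b n
      · rw [Set.indicator_of_mem ht, Set.indicator_of_mem (cons_mem_orderedTimes.2 ⟨hs, ht⟩)]
      · rw [Set.indicator_of_notMem ht,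
          Set.indicator_of_notMem fun h => ht (cons_mem_orderedTimes.1 h).2]
    · simp only [Set.indicator_of_notMem hs, hval]
      rw [← integral_zero (Fin n → ℝ) ℝ]
      refine integral_congr_ae (Filter.Eventually.of_forall fun t => ?_)
      exact Set.indicator_of_notMem (fun h => hs (cons_mem_orderedTimes.1 h).1) _
  · rw [← Measure.volume_eq_prod]
    exact (hmp.integrable_comp_emb (MeasurableEquiv.measurableEmbedding _)).2 hint

theorem setIntegral_holding_eq (lam : S → ℝ) {a b : ℝ} (hab : a ≤ b) (n : ℕ)
    (x : Fin (n + 1) → S) :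
    ∫ t in orderedTimes a b n, ∏ j : Fin (n + 1),
      Real.exp (-(lam (x j) * (⟨n, x, t⟩ : JumpPath S).holdingTime a b j)) =
        holdingIntegral lam b n x a := by
  induction n generalizing a with
  | zero =>
    have : orderedTimes a b 0 = Set.univ := by
      ext t
      simp [orderedTimes, StrictMono]
    rw [this, Measure.restrict_univ]
    simp [JumpPath.holdingTime, holdingIntegral, Fin.snoc, integral_unique, volume_pi, Measure.real]
  | succ n ih =>
    rw [setIntegral_orderedTimes_succ, holdingIntegral, intervalIntegral.integral_of_le hab,
      integral_Ioc_eq_integral_Ioo]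
    · refine setIntegral_congr_fun measurableSet_Ioo fun s hs => ?_
      rw [← ih hs.2.le, ← integral_const_mul]
      refine integral_congr_ae (Filter.Eventually.of_forall fun t => ?_)
      simp only
      rw [Fin.prod_univ_succ, holdingTime_cons_zero]
      simp only [holdingTime_cons_succ]
      rfl
    · refine continuous_finsetProd _ fun j _ => ?_
      have := continuous_holdingTime a b x j
      fun_prop

variable [Fintype S]

/-- The contribution of paths with `n` jumps on `[a, b]` started at a given state, with jump
weights `B`, escape rates `lam` and final weight `γ`. -/
noncomputable def jumpTerm (B : S → S → ℝ) (lam γ : S → ℝ) (b : ℝ) : ℕ → ℝ → S → ℝ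
  | 0, a, z => Real.exp (-(lam z * (b - a))) * γ z
  | n + 1, a, z =>
      ∫ s in a..b, Real.exp (-(lam z * (s - a))) * ∑ y, B z y * jumpTerm B lam γ b n s y

theorem continuous_jumpTerm (B : S → S → ℝ) (lam γ : S → ℝ) (b : ℝ) (n : ℕ) (z : S) :
    Continuous fun a => jumpTerm B lam γ b n a z := by
  induction n generalizing z with
  | zero => unfold jumpTerm; fun_prop
  | succ n ih =>
    have : (fun a => jumpTerm B lam γ b (n + 1) a z) = fun a => -∫ s in b..a,
        Real.exp (-(lam z * (s - a))) * ∑ y, B z y * jumpTerm B lam γ b n s y := by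
      funext a
      rw [jumpTerm, intervalIntegral.integral_symm]
    rw [this]
    refine Continuous.neg ?_
    exact intervalIntegral.continuous_parametric_intervalIntegral_of_continuous
      (f := fun a s => Real.exp (-(lam z * (s - a))) * ∑ y, B z y * jumpTerm B lam γ b n s y)
      (by unfold Function.uncurry; fun_prop) continuous_id

/-- Summing out the states one at a time turns the sum over chains into the recursion of `jumpTerm`.
The initial weight φ is arbitrary because the induction hypothesis is applied with the row B z as
initial weight. -/
theorem sum_holdingIntegral_eq (B : S → S → ℝ) (lam γ φ : S → ℝ) (a b : ℝ) (n : ℕ) :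
    ∑ x : Fin (n + 1) → S, φ (x 0) * ((∏ j : Fin n, B (x j.castSucc) (x j.succ)) *
      γ (x (Fin.last n)) * holdingIntegral lam b n x a) =
        ∑ z, φ z * jumpTerm B lam γ b n a z := by
  induction n generalizing φ a with
  | zero =>
    rw [← (Equiv.funUnique (Fin 1) S).symm.sum_comp]
    refine Finset.sum_congr rfl fun z _ => ?_
    simp [holdingIntegral, jumpTerm, mul_comm]
  | succ n ih =>
    rw [← (Fin.consEquiv fun _ : Fin (n + 2) => S).sum_comp, Fintype.sum_prod_type]
    refine Finset.sum_congr rfl fun z _ => ?_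
    rw [jumpTerm]
    simp_rw [← ih]
    simp only [Fin.consEquiv, Equiv.coe_fn_mk, Fin.cons_zero]
    rw [← Finset.mul_sum]
    congr 1
    simp_rw [Finset.mul_sum]
    rw [intervalIntegral.integral_finsetSum]
    · refine Finset.sum_congr rfl fun x _ => ?_
      rw [Fin.prod_univ_succ, holdingIntegral, ← intervalIntegral.integral_const_mul]
      refine intervalIntegral.integral_congr fun s _ => ?_
      simp only [Fin.tail_cons, Fin.cons_zero, Fin.castSucc_zero, Fin.cons_succ,
        ← Fin.succ_castSucc, ← Fin.succ_last]
      ring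
    · intro x _
      have := continuous_holdingIntegral lam b n x
      exact Continuous.intervalIntegrable (by fun_prop) _ _

/-- Variation of constants: integrate the derivative of exp(-λ(s - a)) V(s) from a to b. -/
theorem jumpTerm_duhamel {B : S → S → ℝ} {lam : S → ℝ} {b : ℝ} {V : ℝ → S → ℝ}
    (hV : ∀ s x, HasDerivAt (fun s => V s x) (lam x * V s x - ∑ y, B x y * V s y) s)
    (a : ℝ) (x : S) :
    V a x = Real.exp (-(lam x * (b - a))) * V b x +
      ∫ s in a..b, Real.exp (-(lam x * (s - a))) * ∑ y, B x y * V s y := by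
  have hcont : ∀ y, Continuous fun s => V s y := fun y =>
    continuous_iff_continuousAt.2 fun s => (hV s y).continuousAt
  have key : ∀ s, HasDerivAt (fun s => -(Real.exp (-(lam x * (s - a))) * V s x))
      (Real.exp (-(lam x * (s - a))) * ∑ y, B x y * V s y) s := by
    intro s
    have h1 : HasDerivAt (fun s => -(lam x * (s - a))) (-(lam x)) s := by
      convert! (((hasDerivAt_id s).sub_const a).const_mul (lam x)).neg using 1
      simp
    convert! (h1.exp.mul (hV s x)).neg using 1
    ring
  rw [intervalIntegral.integral_eq_sub_of_hasDerivAt (fun s _ => key s)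
    (Continuous.intervalIntegrable (by fun_prop) _ _)]
  simp

/-- The remainder after n + 1 terms is the Duhamel integral of the remainder after n terms. The
holding factors are at most 1, so each step costs a factor M and one integration in time, which
produces the factorial. -/
theorem jumpTerm_remainder_le {B : S → S → ℝ} {lam : S → ℝ} {b : ℝ} {V : ℝ → S → ℝ}
    (hB : ∀ x y, 0 ≤ B x y) (hlam : ∀ x, 0 ≤ lam x) {M C : ℝ} (hC : 0 ≤ C)
    (hM : ∀ x, ∑ y, B x y ≤ M)
    (hV : ∀ s x, HasDerivAt (fun s => V s x) (lam x * V s x - ∑ y, B x y * V s y) s)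
    {a₀ : ℝ} (hVC : ∀ s ∈ Set.Icc a₀ b, ∀ x, |V s x| ≤ C) (n : ℕ) :
    ∀ a ∈ Set.Icc a₀ b, ∀ x, |V a x - ∑ k ∈ Finset.range n, jumpTerm B lam (V b) b k a x| ≤
      C * (M ^ n * ((b - a) ^ n / n.factorial)) := by
  have hcont : ∀ y, Continuous fun s => V s y := fun y =>
    continuous_iff_continuousAt.2 fun s => (hV s y).continuousAt
  induction n with
  | zero => intro a ha x; simpa using hVC a ha x
  | succ n ih =>
    intro a ha x
    have hc : ∀ k y, Continuous fun a => jumpTerm B lam (V b) b k a y :=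
      continuous_jumpTerm B lam (V b) b
    have hM0 : 0 ≤ M := (Finset.sum_nonneg fun y _ => hB x y).trans (hM x)
    have hrec : V a x - ∑ k ∈ Finset.range (n + 1), jumpTerm B lam (V b) b k a x =
        ∫ s in a..b, Real.exp (-(lam x * (s - a))) *
          ∑ y, B x y * (V s y - ∑ k ∈ Finset.range n, jumpTerm B lam (V b) b k s y) := by
      rw [Finset.sum_range_succ', jumpTerm_duhamel (b := b) hV a x]
      simp only [jumpTerm]
      rw [← intervalIntegral.integral_finsetSum, add_comm, add_sub_add_right_eq_sub,
        ← intervalIntegral.integral_sub]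
      · refine intervalIntegral.integral_congr fun s _ => ?_
        rw [← Finset.mul_sum, ← mul_sub, Finset.sum_comm, ← Finset.sum_sub_distrib]
        simp only [mul_sub, Finset.mul_sum]
      · exact Continuous.intervalIntegrable (by fun_prop) _ _
      · exact Continuous.intervalIntegrable (by fun_prop) _ _
      · intro k _
        exact Continuous.intervalIntegrable (by fun_prop) _ _
    rw [hrec, ← Real.norm_eq_abs]
    have hbound : ∀ s ∈ Set.Ioc a b, ‖Real.exp (-(lam x * (s - a))) *
        ∑ y, B x y * (V s y - ∑ k ∈ Finset.range n, jumpTerm B lam (V b) b k s y)‖ ≤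
          C * M ^ (n + 1) * ((b - s) ^ n / n.factorial) := by
      intro s hs
      have hs' : s ∈ Set.Icc a₀ b := ⟨ha.1.trans hs.1.le, hs.2⟩
      have hnn : 0 ≤ C * (M ^ n * ((b - s) ^ n / n.factorial)) := by
        have := sub_nonneg.2 hs.2
        positivity
      rw [norm_mul, Real.norm_eq_abs, Real.norm_eq_abs, abs_of_pos (Real.exp_pos _)]
      calc _ ≤ 1 * ∑ y, B x y * (C * (M ^ n * ((b - s) ^ n / n.factorial))) := by
            refine mul_le_mul ?_ ?_ (abs_nonneg _) zero_le_one
            · exact Real.exp_le_one_iff.2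
                (neg_nonpos.2 (mul_nonneg (hlam x) (sub_nonneg.2 hs.1.le)))
            · refine (Finset.abs_sum_le_sum_abs _ _).trans (Finset.sum_le_sum fun y _ => ?_)
              rw [abs_mul, abs_of_nonneg (hB x y)]
              exact mul_le_mul_of_nonneg_left (ih s hs' y) (hB x y)
        _ ≤ M * (C * (M ^ n * ((b - s) ^ n / n.factorial))) := by
            rw [one_mul, ← Finset.sum_mul]
            exact mul_le_mul_of_nonneg_right (hM x) hnn
        _ = _ := by ring
    refine (intervalIntegral.norm_integral_le_of_norm_le ha.2
      (Filter.Eventually.of_forall hbound) (Continuous.intervalIntegrable (by fun_prop) _ _)).trans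
      (le_of_eq ?_)
    have hder : ∀ s, HasDerivAt (fun s => -((b - s) ^ (n + 1) / (n + 1).factorial))
        ((b - s) ^ n / n.factorial) s := by
      intro s
      have h1 : HasDerivAt (fun s => b - s) (-1) s := by
        simpa using (hasDerivAt_id s).const_sub b
      convert! ((h1.pow (n + 1)).div_const ((n + 1).factorial : ℝ)).neg using 1
      rw [Nat.factorial_succ]
      push_cast
      field_simp
    rw [intervalIntegral.integral_const_mul,
      intervalIntegral.integral_eq_sub_of_hasDerivAt (fun s _ => hder s)
        (Continuous.intervalIntegrable (by fun_prop) _ _)]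
    simp
    ring

theorem jumpTerm_nonneg {B : S → S → ℝ} {lam γ : S → ℝ} {b : ℝ}
    (hB : ∀ x y, 0 ≤ B x y) (hγ : ∀ x, 0 ≤ γ x) (n : ℕ) {a : ℝ} (hab : a ≤ b) (z : S) :
    0 ≤ jumpTerm B lam γ b n a z := by
  induction n generalizing a z with
  | zero => exact mul_nonneg (Real.exp_pos _).le (hγ z)
  | succ n ih =>
    rw [jumpTerm]
    refine intervalIntegral.integral_nonneg hab fun s hs => ?_
    exact mul_nonneg (Real.exp_pos _).le
      (Finset.sum_nonneg fun y _ => mul_nonneg (hB z y) (ih hs.2 y))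

/-- The remainder is an exponential-series term and tends to 0; nonnegativity of the terms upgrades
convergence of partial sums to summability. -/
theorem hasSum_jumpTerm {B : S → S → ℝ} {lam : S → ℝ} {b : ℝ} {V : ℝ → S → ℝ}
    (hB : ∀ x y, 0 ≤ B x y) (hlam : ∀ x, 0 ≤ lam x) (hγ : ∀ x, 0 ≤ V b x)
    (hV : ∀ s x, HasDerivAt (fun s => V s x) (lam x * V s x - ∑ y, B x y * V s y) s)
    {a : ℝ} (hab : a ≤ b) (x : S) :
    HasSum (fun n => jumpTerm B lam (V b) b n a x) (V a x) := by
  have hcont : ∀ y, Continuous fun s => V s y := fun y =>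
    continuous_iff_continuousAt.2 fun s => (hV s y).continuousAt
  have hc : ∀ y, ∃ C, ∀ s ∈ Set.Icc a b, |V s y| ≤ C := fun y =>
    (isCompact_Icc (a := a) (b := b)).exists_bound_of_continuousOn (hcont y).continuousOn
  choose C hC using hc
  have hC0 : ∀ y, 0 ≤ C y := fun y => (abs_nonneg _).trans (hC y a ⟨le_rfl, hab⟩)
  have hM : ∀ x, ∑ y, B x y ≤ ∑ x, ∑ y, B x y := fun x =>
    Finset.single_le_sum (f := fun x => ∑ y, B x y)
      (fun i _ => Finset.sum_nonneg fun y _ => hB i y) (Finset.mem_univ x)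
  have hrem := jumpTerm_remainder_le hB hlam (Finset.sum_nonneg fun y _ => hC0 y) hM hV
    (a₀ := a) (fun s hs y => (hC y s hs).trans
      (Finset.single_le_sum (fun i _ => hC0 i) (Finset.mem_univ y)))
  rw [hasSum_iff_tendsto_nat_of_nonneg (fun n => jumpTerm_nonneg hB hγ n hab x)]
  rw [tendsto_iff_norm_sub_tendsto_zero]
  refine squeeze_zero (g := fun n : ℕ =>
    (∑ y, C y) * (((∑ x, ∑ y, B x y) * (b - a)) ^ n / n.factorial))
    (fun _ => norm_nonneg _) (fun n => ?_) ?_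
  · rw [norm_sub_rev, Real.norm_eq_abs, mul_pow, mul_div_assoc]
    exact hrem n a ⟨le_rfl, hab⟩ x
  · simpa using (FloorSemiring.tendsto_pow_div_factorial_atTop
      ((∑ x, ∑ y, B x y) * (b - a))).const_mul (∑ y, C y)

/-- `pathIntegral` skips chains with a repeated consecutive state, whereas the Duhamel series runs
over all chains; the two agree because B vanishes on the diagonal. -/
theorem pathIntegral_eq {B : S → S → ℝ} {lam φ : S → ℝ} {b : ℝ} {V : ℝ → S → ℝ}
    (hB : ∀ x y, 0 ≤ B x y) (hBd : ∀ x, B x x = 0) (hlam : ∀ x, 0 ≤ lam x)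
    (hγ : ∀ x, 0 ≤ V b x)
    (hV : ∀ s x, HasDerivAt (fun s => V s x) (lam x * V s x - ∑ y, B x y * V s y) s)
    {a : ℝ} (hab : a ≤ b) {f : JumpPath S → ℝ}
    (hf : ∀ w : JumpPath S, (∀ j : Fin w.n, w.state j.castSucc ≠ w.state j.succ) →
      f w = φ w.first * (∏ j : Fin w.n, B (w.state j.castSucc) (w.state j.succ)) * V b w.last *
        ∏ j, Real.exp (-(lam (w.state j) * w.holdingTime a b j))) [DecidableEq S] :
    pathIntegral a b f = ∑ z, φ z * V a z := by
  have hs : HasSum (fun n => ∑ z, φ z * jumpTerm B lam (V b) b n a z) (∑ z, φ z * V a z) :=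
    hasSum_sum fun z _ => (hasSum_jumpTerm hB hlam hγ hV hab z).mul_left (φ z)
  rw [← hs.tsum_eq, pathIntegral]
  refine tsum_congr fun n => ?_
  rw [← sum_holdingIntegral_eq]
  refine Finset.sum_congr rfl fun x _ => ?_
  rw [← setIntegral_holding_eq lam hab]
  split_ifs with h
  · rw [← mul_assoc, ← integral_const_mul]
    refine integral_congr_ae (Filter.Eventually.of_forall fun t => ?_)
    simp only
    rw [hf ⟨n, x, t⟩ h, ← mul_assoc]
    rfl
  · push Not at h
    obtain ⟨j, hj⟩ := h
    rw [Finset.prod_eq_zero (Finset.mem_univ j) (by rw [hj, hBd])]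
    simp

end PathExpansion

/-! ### Perron eigenvectors of irreducible nonnegative matrices -/

section PerronFrobenius

variable {S : Type*} [Fintype S]

/-- A positive diagonal lets a chain wait, so an entry that is positive in one power stays positive
in all higher ones. A single exponent therefore serves all pairs. -/
theorem exists_pos_pow_of_reflTransGen [DecidableEq S] {A : Matrix S S ℝ} (hA : ∀ x y, 0 ≤ A x y)
    (hd : ∀ x, 0 < A x x) (hirr : ∀ x y, Relation.ReflTransGen (fun a b => 0 < A a b) x y) :
    ∃ N : ℕ, ∀ x y, 0 < (A ^ N) x y := by
  have hnn : ∀ (n : ℕ) x y, 0 ≤ (A ^ n) x y := by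
    intro n
    induction n with
    | zero => intro x y; rw [pow_zero, Matrix.one_apply]; split_ifs <;> norm_num
    | succ n ih =>
      intro x y
      rw [pow_succ, Matrix.mul_apply]
      exact Finset.sum_nonneg fun z _ => mul_nonneg (ih x z) (hA z y)
  have hstep : ∀ (n : ℕ) x y z, 0 < (A ^ n) x y → 0 < A y z → 0 < (A ^ (n + 1)) x z := by
    intro n x y z h1 h2
    rw [pow_succ, Matrix.mul_apply]
    exact (mul_pos h1 h2).trans_le (Finset.single_le_sum
      (f := fun j => (A ^ n) x j * A j z)
      (fun j _ => mul_nonneg (hnn n x j) (hA j z)) (Finset.mem_univ y))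
  have hex : ∀ x y, ∃ n : ℕ, 0 < (A ^ n) x y := by
    intro x y
    induction hirr x y with
    | refl => exact ⟨0, by simp⟩
    | tail _ h ih =>
      obtain ⟨n, hn⟩ := ih
      exact ⟨n + 1, hstep n _ _ _ hn h⟩
  choose n hn using hex
  have hmono : ∀ x y (k l : ℕ), k ≤ l → 0 < (A ^ k) x y → 0 < (A ^ l) x y := by
    intro x y k l hkl h
    induction l, hkl using Nat.le_induction with
    | base => exact h
    | succ m _ ih => exact hstep m x y y ih (hd y)
  refine ⟨∑ x, ∑ y, n x y, fun x y => hmono x y _ _ ?_ (hn x y)⟩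
  exact (Finset.single_le_sum (f := fun y => n x y) (fun _ _ => Nat.zero_le _)
    (Finset.mem_univ y)).trans (Finset.single_le_sum (f := fun x => ∑ y, n x y)
    (fun _ _ => Nat.zero_le _) (Finset.mem_univ x))

/-- Perron's theorem: an irreducible nonnegative matrix with positive diagonal has an eigenvector
with positive entries. -/
theorem exists_pos_eigenvector [DecidableEq S] [Nonempty S] {A : Matrix S S ℝ}
    (hA : ∀ x y, 0 ≤ A x y) (hd : ∀ x, 0 < A x x)
    (hirr : ∀ x y, Relation.ReflTransGen (fun a b => 0 < A a b) x y) :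
    ∃ (μ : ℝ) (r : S → ℝ), (∀ x, 0 < r x) ∧ A.mulVec r = μ • r := by
  obtain ⟨N, hN⟩ := exists_pos_pow_of_reflTransGen hA hd hirr
  have hpos : ∀ v : S → ℝ, (∀ x, 0 ≤ v x) → v ≠ 0 → ∀ x, 0 < (A ^ N).mulVec v x := by
    intro v hv hv0 x
    obtain ⟨y, hy⟩ := Function.ne_iff.1 hv0
    rw [Matrix.mulVec, dotProduct]
    exact Finset.sum_pos' (fun z _ => mul_nonneg (hN x z).le (hv z))
      ⟨y, Finset.mem_univ y, mul_pos (hN x y) (lt_of_le_of_ne (hv y) (Ne.symm hy))⟩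
  set M : ℝ := ∑ x, ∑ y, A x y with hMdef
  have hbd : ∀ v ∈ stdSimplex ℝ S, ∀ μ : ℝ, (∀ x, μ * v x ≤ A.mulVec v x) → μ ≤ M := by
    intro v hv μ h
    calc μ = ∑ x, μ * v x := by rw [← Finset.mul_sum, hv.2, mul_one]
      _ ≤ ∑ x, A.mulVec v x := Finset.sum_le_sum fun x _ => h x
      _ ≤ M := Finset.sum_le_sum fun x _ => Finset.sum_le_sum fun y _ =>
          mul_le_of_le_one_right (hA x y) (by
            rw [← hv.2]
            exact Finset.single_le_sum (fun i _ => hv.1 i) (Finset.mem_univ y))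
  -- Collatz–Wielandt: maximise μ over pairs (v, μ) with v in the simplex and μ v ≤ A v; by `hbd`
  -- the range of μ may be cut off at M.
  have hcomp : IsCompact ((stdSimplex ℝ S ×ˢ Set.Icc (0 : ℝ) M) ∩
      {p : (S → ℝ) × ℝ | ∀ x, p.2 * p.1 x ≤ A.mulVec p.1 x}) := by
    refine ((isCompact_stdSimplex ℝ S).prod isCompact_Icc).inter_right ?_
    have : {p : (S → ℝ) × ℝ | ∀ x, p.2 * p.1 x ≤ A.mulVec p.1 x} =
        ⋂ x, {p : (S → ℝ) × ℝ | p.2 * p.1 x ≤ A.mulVec p.1 x} := by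
      ext p; simp
    rw [this]
    refine isClosed_iInter fun x => isClosed_le (by fun_prop) ?_
    simp only [Matrix.mulVec, dotProduct]
    fun_prop
  obtain ⟨x₀⟩ := ‹Nonempty S›
  have hs0 : Pi.single x₀ (1 : ℝ) ∈ stdSimplex ℝ S := single_mem_stdSimplex ℝ x₀
  have hM0 : 0 ≤ M := Finset.sum_nonneg fun x _ => Finset.sum_nonneg fun y _ => hA x y
  obtain ⟨⟨v, μ⟩, ⟨⟨hv, hμ⟩, hvμ⟩, hmax⟩ := hcomp.exists_isMaxOn
    ⟨(Pi.single x₀ 1, 0), ⟨⟨hs0, ⟨le_rfl, hM0⟩⟩, fun x => by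
      simp only [zero_mul, Matrix.mulVec, dotProduct]
      exact Finset.sum_nonneg fun y _ => mul_nonneg (hA x y) (hs0.1 y)⟩⟩ continuous_snd.continuousOn
  simp only at hv hμ
  have hvμ' : ∀ x, μ * v x ≤ A.mulVec v x := hvμ
  have hv0 : v ≠ 0 := by
    rintro rfl
    simpa using hv.2
  have heig : A.mulVec v = μ • v := by
    by_contra hne
    have hz0 : A.mulVec v - μ • v ≠ 0 := sub_ne_zero.2 hne
    have hz : ∀ x, 0 ≤ (A.mulVec v - μ • v) x := fun x => by
      simpa using hvμ' x
    have hTz := hpos _ hz hz0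
    have hy := hpos v hv.1 hv0
    set y := (A ^ N).mulVec v with hydef
    have hTz' : ∀ x, (A ^ N).mulVec (A.mulVec v - μ • v) x = A.mulVec y x - μ * y x := by
      intro x
      rw [Matrix.mulVec_sub, Matrix.mulVec_smul, Matrix.mulVec_mulVec, ← pow_succ, pow_succ',
        ← Matrix.mulVec_mulVec]
      rfl
    obtain ⟨x₁, -, hx₁⟩ := Finset.exists_min_image Finset.univ
      (fun x => (A.mulVec y x - μ * y x) / y x) ⟨x₀, Finset.mem_univ _⟩
    set δ := (A.mulVec y x₁ - μ * y x₁) / y x₁ with hδ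
    have hδ0 : 0 < δ := div_pos (hTz' x₁ ▸ hTz x₁) (hy x₁)
    have hYpos : 0 < ∑ x, y x := Finset.sum_pos (fun x _ => hy x) ⟨x₀, Finset.mem_univ _⟩
    have hle : ∀ x, (μ + δ) * y x ≤ A.mulVec y x := by
      intro x
      have := (le_div_iff₀ (hy x)).1 (hx₁ x (Finset.mem_univ x))
      linarith
    have hmem : (∑ x, y x)⁻¹ • y ∈ stdSimplex ℝ S := by
      refine ⟨fun x => by
        simp only [Pi.smul_apply, smul_eq_mul]; exact mul_nonneg (inv_pos.2 hYpos).le (hy x).le, ?_⟩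
      simp only [Pi.smul_apply, smul_eq_mul]
      rw [← Finset.mul_sum, inv_mul_cancel₀ hYpos.ne']
    have hle' : ∀ x, (μ + δ) * ((∑ x, y x)⁻¹ • y) x ≤ A.mulVec ((∑ x, y x)⁻¹ • y) x := by
      intro x
      rw [Matrix.mulVec_smul]
      simp only [Pi.smul_apply, smul_eq_mul]
      rw [mul_left_comm]
      exact mul_le_mul_of_nonneg_left (hle x) (inv_pos.2 hYpos).le
    have : μ + δ ≤ μ := hmax (a := ((∑ x, y x)⁻¹ • y, μ + δ))
      ⟨⟨hmem, ⟨by linarith [hμ.1], hbd _ hmem _ hle'⟩⟩, hle'⟩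
    linarith
  -- No entry of v vanishes, since A ^ N v = μ ^ N v is positive everywhere.
  refine ⟨μ, v, fun x => lt_of_le_of_ne (hv.1 x) fun h => ?_, heig⟩
  have hpow : ∀ n : ℕ, (A ^ n).mulVec v = μ ^ n • v := by
    intro n
    induction n with
    | zero => simp
    | succ n ih => rw [pow_succ, ← Matrix.mulVec_mulVec, heig, Matrix.mulVec_smul, ih, smul_smul,
        ← pow_succ']
  have := hpos v hv.1 hv0 x
  rw [hpow] at this
  simp [← h] at this

/-- Adding s times the identity, with s larger than every `lam x`, makes the matrix nonnegative with
positive diagonal and only shifts the eigenvalue. -/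
theorem exists_pos_eigenvector_of_offDiag [DecidableEq S] [Nonempty S] {B : S → S → ℝ}
    (hB : ∀ x y, 0 ≤ B x y) (lam : S → ℝ)
    (hirr : ∀ x y, Relation.ReflTransGen (fun a b => 0 < B a b) x y) :
    ∃ (μ : ℝ) (r : S → ℝ), (∀ x, 0 < r x) ∧ ∀ x, ∑ y, B x y * r y - lam x * r x = μ * r x := by
  set s : ℝ := 1 + ∑ x, |lam x| with hs
  have hs' : ∀ x, 0 < s - lam x := fun x => by
    have := Finset.single_le_sum (f := fun x => |lam x|) (fun i _ => abs_nonneg _)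
      (Finset.mem_univ x)
    have := le_abs_self (lam x)
    linarith
  obtain ⟨μ, r, hr, h⟩ := exists_pos_eigenvector
    (A := Matrix.of fun x y => B x y + if x = y then s - lam x else 0)
    (fun x y => by
      simp only [Matrix.of_apply]
      split_ifs
      · exact add_nonneg (hB x y) (hs' x).le
      · simpa using hB x y)
    (fun x => by
      simp only [Matrix.of_apply, if_true]
      exact add_pos_of_nonneg_of_pos (hB x x) (hs' x))
    (fun x y => Relation.ReflTransGen.mono (fun a b (hab : 0 < B a b) => by
      change 0 < B a b + if a = b then s - lam a else 0
      split_ifs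
      · exact add_pos hab (hs' a)
      · simpa using hab) x y (hirr x y))
  refine ⟨μ - s, r, hr, fun x => ?_⟩
  have hx := congrFun h x
  simp only [Matrix.mulVec, dotProduct, Matrix.of_apply, add_mul, Finset.sum_add_distrib,
    ite_mul, zero_mul, Finset.sum_ite_eq, Finset.mem_univ, if_true, Pi.smul_apply,
    smul_eq_mul] at hx
  linarith

end PerronFrobenius

/-! ### Relaxation to the stationary mean through decay of variance -/

section Relaxation

variable {S : Type*} [Fintype S]

theorem exists_linear_flow [DecidableEq S] (A : Matrix S S ℝ) (γ : S → ℝ) :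
    ∃ V : ℝ → S → ℝ, V 0 = γ ∧
      ∀ t x, HasDerivAt (fun t => V t x) (∑ y, A x y * V t y) t := by
  let L : (S → ℝ) →L[ℝ] (S → ℝ) := LinearMap.toContinuousLinearMap (Matrix.toLin' A)
  refine ⟨fun t => NormedSpace.exp (t • L) γ, by simp, fun t x => ?_⟩
  have h := (hasDerivAt_exp_smul_const' (𝕂 := ℝ) L t).clm_apply (hasDerivAt_const t γ)
  have h2 := (hasDerivAt_pi.1 h) x
  convert! h2 using 1
  simp [L, Matrix.mulVec, dotProduct]

/-- The Dirichlet form of an irreducible chain controls all differences. -/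
theorem exists_sq_sub_le_dirichlet {B : S → S → ℝ} {p : S → ℝ} (hB : ∀ x y, 0 ≤ B x y)
    (hp : ∀ x, 0 < p x) (hirr : ∀ x y, Relation.ReflTransGen (fun a b => 0 < B a b) x y) :
    ∃ C : ℝ, 0 < C ∧ ∀ (f : S → ℝ) x y,
      (f x - f y) ^ 2 ≤ C * ∑ x, ∑ y, p x * B x y * (f x - f y) ^ 2 := by
  have hD : ∀ (f : S → ℝ) x y, p x * B x y * (f x - f y) ^ 2 ≤
      ∑ x, ∑ y, p x * B x y * (f x - f y) ^ 2 := fun f x y =>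
    have hnn : ∀ x y, 0 ≤ p x * B x y * (f x - f y) ^ 2 := fun x y =>
      mul_nonneg (mul_nonneg (hp x).le (hB x y)) (sq_nonneg _)
    (Finset.single_le_sum (f := fun y => p x * B x y * (f x - f y) ^ 2)
      (fun j _ => hnn x j) (Finset.mem_univ y)).trans
      (Finset.single_le_sum (f := fun x => ∑ y, p x * B x y * (f x - f y) ^ 2)
        (fun i _ => Finset.sum_nonneg fun j _ => hnn i j) (Finset.mem_univ x))
  have hD0 : ∀ f : S → ℝ, 0 ≤ ∑ x, ∑ y, p x * B x y * (f x - f y) ^ 2 := fun f =>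
    Finset.sum_nonneg fun x _ => Finset.sum_nonneg fun y _ =>
      mul_nonneg (mul_nonneg (hp x).le (hB x y)) (sq_nonneg _)
  have hex : ∀ x y, ∃ C : ℝ, 0 ≤ C ∧ ∀ f : S → ℝ,
      (f x - f y) ^ 2 ≤ C * ∑ x, ∑ y, p x * B x y * (f x - f y) ^ 2 := by
    intro x y
    induction hirr x y with
    | refl => exact ⟨0, le_rfl, fun f => by simp⟩
    | @tail y z _ hyz ih =>
      obtain ⟨C, hC, h⟩ := ih
      have hpos := mul_pos (hp y) hyz
      -- From (u + v)² ≤ 2u² + 2v², with the last edge paid for by its own term in the Dirichlet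
      -- form.
      refine ⟨2 * C + 2 * (p y * B y z)⁻¹, by positivity, fun f => ?_⟩
      have h1 := h f
      have h2 : (f y - f z) ^ 2 ≤
          (p y * B y z)⁻¹ * ∑ x, ∑ y, p x * B x y * (f x - f y) ^ 2 := by
        rw [← div_eq_inv_mul, le_div_iff₀' hpos]
        exact hD f y z
      nlinarith [sq_nonneg ((f x - f y) - (f y - f z))]
  choose C hC h using hex
  refine ⟨1 + ∑ x, ∑ y, C x y, ?_, fun f x y => (h x y f).trans ?_⟩
  · have : 0 ≤ ∑ x, ∑ y, C x y :=
      Finset.sum_nonneg fun x _ => Finset.sum_nonneg fun y _ => hC x y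
    linarith
  · refine mul_le_mul_of_nonneg_right ?_ (hD0 f)
    have h1 := Finset.single_le_sum (f := fun y => C x y) (fun j _ => hC x j) (Finset.mem_univ y)
    have h2 := Finset.single_le_sum (f := fun x => ∑ y, C x y)
      (fun i _ => Finset.sum_nonneg fun j _ => hC i j) (Finset.mem_univ x)
    linarith

/-- Relaxation of the backward equation of an irreducible Markov jump process to the mean with
respect to its stationary distribution. -/
theorem tendsto_of_hasDerivAt_generator {B : S → S → ℝ} {p : S → ℝ} (hB : ∀ x y, 0 ≤ B x y)
    (hp : ∀ x, 0 < p x) (hp1 : ∑ x, p x = 1)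
    (hirr : ∀ x y, Relation.ReflTransGen (fun a b => 0 < B a b) x y)
    (hinv : ∀ y, ∑ x, p x * B x y = p y * ∑ x, B y x)
    {f : ℝ → S → ℝ}
    (hf : ∀ t x, HasDerivAt (fun t => f t x) (∑ y, B x y * (f t y - f t x)) t) (x : S) :
    Filter.Tendsto (fun t => f t x) Filter.atTop (nhds (∑ y, p y * f 0 y)) := by
  obtain ⟨C, hC, hdir⟩ := exists_sq_sub_le_dirichlet hB hp hirr
  have hinv' : ∀ g : S → ℝ, ∑ x, ∑ y, p x * B x y * (g y - g x) = 0 := by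
    intro g
    simp only [mul_sub, Finset.sum_sub_distrib]
    rw [Finset.sum_comm, sub_eq_zero]
    refine Finset.sum_congr rfl fun y _ => ?_
    rw [← Finset.sum_mul, hinv, Finset.mul_sum, Finset.sum_mul]
  have hmean : ∀ t, ∑ y, p y * f t y = ∑ y, p y * f 0 y := by
    intro t
    refine is_const_of_deriv_eq_zero (f := fun t => ∑ y, p y * f t y) ?_ ?_ t 0
    · exact fun t => (HasDerivAt.fun_sum fun y _ => (hf t y).const_mul (p y)).differentiableAt
    · intro t
      rw [(HasDerivAt.fun_sum fun y (_ : y ∈ Finset.univ) => (hf t y).const_mul (p y)).deriv]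
      simpa only [Finset.mul_sum, mul_assoc] using hinv' (f t)
  set m := ∑ y, p y * f 0 y with hm
  -- The variance decreases at the rate of the Dirichlet form. Reversibility is not needed:
  -- invariance of p applied to (f - m)² supplies the missing square.
  have hvar : ∀ t, HasDerivAt (fun t => ∑ y, p y * (f t y - m) ^ 2)
      (-∑ x, ∑ y, p x * B x y * (f t x - f t y) ^ 2) t := by
    intro t
    have h := HasDerivAt.fun_sum fun y (_ : y ∈ Finset.univ) =>
      (((hf t y).sub_const m).pow 2).const_mul (p y)
    convert! h using 1
    have h0 := hinv' fun y => (f t y - m) ^ 2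
    rw [neg_eq_iff_add_eq_zero, ← h0, ← Finset.sum_add_distrib]
    refine Finset.sum_congr rfl fun x _ => ?_
    simp only [Finset.mul_sum]
    rw [← Finset.sum_add_distrib]
    refine Finset.sum_congr rfl fun y _ => ?_
    simp only [Nat.cast_ofNat, Nat.add_one_sub_one, pow_one]
    ring
  -- A Poincaré inequality: f - m is an average of differences, each controlled by the Dirichlet
  -- form.
  have hvarle : ∀ t, ∑ y, p y * (f t y - m) ^ 2 ≤
      C * ∑ x, ∑ y, p x * B x y * (f t x - f t y) ^ 2 := by
    intro t
    set D := C * ∑ x, ∑ y, p x * B x y * (f t x - f t y) ^ 2 with hDdef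
    have hpt : ∀ x, (f t x - m) ^ 2 ≤ D := by
      intro x
      have h1 : f t x - m = ∑ y, p y * (f t x - f t y) := by
        simp only [mul_sub, Finset.sum_sub_distrib, hmean t]
        rw [← Finset.sum_mul, hp1, one_mul]
      have h2 : |f t x - m| ≤ Real.sqrt D := by
        rw [h1]
        calc _ ≤ ∑ y, |p y * (f t x - f t y)| := Finset.abs_sum_le_sum_abs _ _
          _ ≤ ∑ y, p y * Real.sqrt D := Finset.sum_le_sum fun y _ => by
              rw [abs_mul, abs_of_pos (hp y)]
              exact mul_le_mul_of_nonneg_left (Real.abs_le_sqrt (hdir (f t) x y)) (hp y).le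
          _ = _ := by rw [← Finset.sum_mul, hp1, one_mul]
      have hD0 : 0 ≤ D := (sq_nonneg _).trans (hdir (f t) x x)
      calc (f t x - m) ^ 2 = |f t x - m| ^ 2 := (sq_abs _).symm
        _ ≤ Real.sqrt D ^ 2 := pow_le_pow_left₀ (abs_nonneg _) h2 2
        _ = D := Real.sq_sqrt hD0
    calc _ ≤ ∑ y, p y * D := Finset.sum_le_sum fun y _ =>
          mul_le_mul_of_nonneg_left (hpt y) (hp y).le
      _ = D := by rw [← Finset.sum_mul, hp1, one_mul]
  have hderexp : ∀ t, HasDerivAt (fun t => Real.exp (t / C) * ∑ y, p y * (f t y - m) ^ 2)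
      (Real.exp (t / C) * (1 / C) * (∑ y, p y * (f t y - m) ^ 2) +
        Real.exp (t / C) * -∑ x, ∑ y, p x * B x y * (f t x - f t y) ^ 2) t := fun t =>
    ((hasDerivAt_id t).div_const C).exp.mul (hvar t)
  -- Grönwall: the last two facts make exp(t / C) times the variance nonincreasing.
  have hanti : Antitone fun t => Real.exp (t / C) * ∑ y, p y * (f t y - m) ^ 2 := by
    refine antitone_of_deriv_nonpos (fun t => (hderexp t).differentiableAt) fun t => ?_
    rw [(hderexp t).deriv, mul_assoc, ← mul_add]
    refine mul_nonpos_of_nonneg_of_nonpos (Real.exp_pos _).le ?_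
    have := hvarle t
    rw [one_div, ← div_eq_inv_mul]
    rw [← div_le_iff₀' hC] at this
    linarith
  rw [tendsto_iff_norm_sub_tendsto_zero]
  set W := ∑ y, p y * (f 0 y - m) ^ 2 with hW
  have hsq : ∀ t, 0 ≤ t → ‖f t x - m‖ ≤ Real.sqrt (W / p x * Real.exp (-(t / C))) := by
    intro t ht
    rw [Real.norm_eq_abs]
    refine Real.abs_le_sqrt ?_
    have h1 := hanti ht
    simp only [zero_div, Real.exp_zero, one_mul] at h1
    have h2 : p x * (f t x - m) ^ 2 ≤ ∑ y, p y * (f t y - m) ^ 2 :=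
      Finset.single_le_sum (f := fun y => p y * (f t y - m) ^ 2)
        (fun y _ => mul_nonneg (hp y).le (sq_nonneg _)) (Finset.mem_univ x)
    rw [Real.exp_neg, div_mul_eq_mul_div, le_div_iff₀' (hp x), ← div_eq_mul_inv,
      le_div_iff₀' (Real.exp_pos _)]
    exact (mul_le_mul_of_nonneg_left h2 (Real.exp_pos _).le).trans h1
  refine squeeze_zero' (Filter.Eventually.of_forall fun _ => norm_nonneg _)
    (Filter.eventually_atTop.2 ⟨0, fun t ht => hsq t ht⟩) ?_
  have hlim : Filter.Tendsto (fun t : ℝ => W / p x * Real.exp (-(t / C))) Filter.atTop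
      (nhds (W / p x * 0)) :=
    (Real.tendsto_exp_neg_atTop_nhds_zero.comp
      (Filter.tendsto_id.atTop_div_const hC)).const_mul _
  simpa using hlim.sqrt

end Relaxation

/-! ### Uniform perturbation estimates and bounds on the entropy gap -/

section Estimates

variable {S : Type*} [Fintype S]

theorem abs_sum_le_card_mul {f : S → ℝ} {k : ℝ} (h : ∀ x, |f x| ≤ k) :
    |∑ x, f x| ≤ Fintype.card S * k :=
  (Finset.abs_sum_le_sum_abs _ _).trans
    ((Finset.sum_le_sum fun x _ => h x).trans (by simp))

theorem abs_weightedSum_le {p f : S → ℝ} {k : ℝ} (hp : ∀ x, 0 ≤ p x) (hp1 : ∑ x, p x = 1)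
    (h : ∀ x, |f x| ≤ k) : |∑ x, p x * f x| ≤ k := by
  calc _ ≤ ∑ x, |p x * f x| := Finset.abs_sum_le_sum_abs _ _
    _ ≤ ∑ x, p x * k := Finset.sum_le_sum fun x _ => by
        rw [abs_mul, abs_of_nonneg (hp x)]
        exact mul_le_mul_of_nonneg_left (h x) (hp x)
    _ = k := by rw [← Finset.sum_mul, hp1, one_mul]

theorem abs_sub_mean_le {p v : S → ℝ} {k : ℝ} (hp : ∀ x, 0 ≤ p x) (hp1 : ∑ x, p x = 1)
    (h : ∀ x y, v x - v y ≤ k) (x : S) : |v x - ∑ y, p y * v y| ≤ k := by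
  have : v x - ∑ y, p y * v y = ∑ y, p y * (v x - v y) := by
    simp only [mul_sub, Finset.sum_sub_distrib]
    rw [← Finset.sum_mul, hp1, one_mul]
  rw [this]
  exact abs_weightedSum_le hp hp1 fun y => abs_le.2 ⟨by linarith [h y x], h x y⟩

/-- A function that is almost harmonic for a connected family of rates is almost constant,
uniformly over all rates that are bounded above and bounded below on the edges. -/
theorem exists_oscillation_bound {c : S → S → ℝ} (hconn : IsConnected c) {m M : ℝ} (hm : 0 < m) :
    ∃ C : ℝ, 0 < C ∧ ∀ (A : S → S → ℝ) (v : S → ℝ) (δ : ℝ), (∀ x y, 0 ≤ A x y) →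
      (∀ x y, A x y ≤ M) → (∀ x y, x ≠ y → c x y ≠ 0 → m ≤ A x y) → 0 ≤ δ →
      (∀ x, |∑ y, A x y * (v x - v y)| ≤ δ) → ∀ x y, v x - v y ≤ C * δ := by
  -- Maximum principle along a chain from a maximum x of v. All v x - v w are nonnegative, so one
  -- term of ∑ A y w (v x - v w) is at most the whole sum, which is the row sum at y times v x - v y
  -- plus a defect of size δ.
  have hex : ∀ x y, ∃ C : ℝ, 0 ≤ C ∧ ∀ (A : S → S → ℝ) (v : S → ℝ) (δ : ℝ), (∀ x y, 0 ≤ A x y) →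
      (∀ x y, A x y ≤ M) → (∀ x y, x ≠ y → c x y ≠ 0 → m ≤ A x y) → 0 ≤ δ →
      (∀ x, |∑ y, A x y * (v x - v y)| ≤ δ) → (∀ z, v z ≤ v x) → v x - v y ≤ C * δ := by
    intro x y
    induction hconn x y with
    | refl => exact ⟨0, le_rfl, fun A v δ _ _ _ _ _ _ => by simp⟩
    | @tail y z _ hyz ih =>
      obtain ⟨C, hC, h⟩ := ih
      refine ⟨(1 + Fintype.card S * |M| * C) / m, by positivity,
        fun A v δ hA hAM hAm hδ hv hmax => ?_⟩
      have h1 := h A v δ hA hAM hAm hδ hv hmax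
      have hd : ∀ w, 0 ≤ v x - v w := fun w => sub_nonneg.2 (hmax w)
      have h2 : A y z * (v x - v z) ≤ ∑ w, A y w * (v x - v w) :=
        Finset.single_le_sum (f := fun w => A y w * (v x - v w))
          (fun w _ => mul_nonneg (hA y w) (hd w)) (Finset.mem_univ z)
      have h3 : ∑ w, A y w * (v x - v w) =
          (∑ w, A y w) * (v x - v y) + ∑ w, A y w * (v y - v w) := by
        rw [Finset.sum_mul, ← Finset.sum_add_distrib]
        exact Finset.sum_congr rfl fun w _ => by ring
      have h4 : ∑ w, A y w ≤ Fintype.card S * |M| :=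
        (le_abs_self _).trans (abs_sum_le_card_mul fun w => by
          rw [abs_of_nonneg (hA y w)]
          exact (hAM y w).trans (le_abs_self M))
      have h5 : (∑ w, A y w) * (v x - v y) ≤ Fintype.card S * |M| * (C * δ) :=
        mul_le_mul h4 h1 (hd y) (by positivity)
      have h6 := (abs_le.1 (hv y)).2
      have h7 : m * (v x - v z) ≤ A y z * (v x - v z) :=
        mul_le_mul_of_nonneg_right (hAm y z hyz.1 hyz.2) (hd z)
      rw [div_mul_eq_mul_div, le_div_iff₀' hm]
      linarith
  choose C hC h using hex
  refine ⟨1 + ∑ x, ∑ y, C x y, ?_, fun A v δ hA hAM hAm hδ hv x y => ?_⟩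
  · have : 0 ≤ ∑ x, ∑ y, C x y :=
      Finset.sum_nonneg fun x _ => Finset.sum_nonneg fun y _ => hC x y
    linarith
  · obtain ⟨z, -, hz⟩ := Finset.exists_max_image Finset.univ v ⟨x, Finset.mem_univ x⟩
    have h0 := h z y A v δ hA hAM hAm hδ hv fun w => hz w (Finset.mem_univ w)
    have h1 := Finset.single_le_sum (f := fun y => C z y) (fun j _ => hC z j) (Finset.mem_univ y)
    have h2 := Finset.single_le_sum (f := fun x => ∑ y, C x y)
      (fun i _ => Finset.sum_nonneg fun j _ => hC i j) (Finset.mem_univ z)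
    have h3 := hz x (Finset.mem_univ x)
    calc v x - v y ≤ v z - v y := by linarith
      _ ≤ C z y * δ := h0
      _ ≤ _ := mul_le_mul_of_nonneg_right (by linarith) hδ

/-- With s = max |v - 1| the defect is at most κ(1 + s), and the p-mean of v is 1. Hence s ≤ Cκ(1 +
s), and Cκ ≤ 1/2 absorbs the term with s. -/
theorem abs_sub_one_le_of_oscillation {p v : S → ℝ} {A : S → S → ℝ} {C κ : ℝ}
    (hp : ∀ x, 0 ≤ p x) (hp1 : ∑ x, p x = 1) (hκ : 0 ≤ κ) (hCκ : C * κ ≤ 1 / 2)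
    (hosc : ∀ δ, 0 ≤ δ → (∀ x, |∑ y, A x y * (v x - v y)| ≤ δ) → ∀ x y, v x - v y ≤ C * δ)
    (hv1 : ∑ x, p x * v x = 1) (hv : ∀ x, |∑ y, A x y * (v x - v y)| ≤ κ * |v x|) (x : S) :
    |v x - 1| ≤ 2 * C * κ := by
  obtain ⟨z, -, hz⟩ := Finset.exists_max_image Finset.univ (fun x => |v x - 1|)
    ⟨x, Finset.mem_univ x⟩
  have habs : ∀ y, |v y| ≤ 1 + |v z - 1| := fun y => by
    have h1 := hz y (Finset.mem_univ y)
    have h2 : |v y| ≤ |v y - 1| + |(1 : ℝ)| := by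
      simpa using abs_add_le (v y - 1) 1
    rw [abs_one] at h2
    linarith
  have h1 := hosc (κ * (1 + |v z - 1|)) (by positivity) fun y =>
    (hv y).trans (mul_le_mul_of_nonneg_left (habs y) hκ)
  have h2 := abs_sub_mean_le hp hp1 h1 z
  rw [hv1] at h2
  have h3 := hz x (Finset.mem_univ x)
  nlinarith [mul_le_mul_of_nonneg_right hCκ (abs_nonneg (v z - 1))]

set_option maxHeartbeats 1000000 in
/-- Second-order perturbation theory for the Perron eigenvector `r` of the geometric mean `T` of
the rates `R` and `Q`, where `R` has the harmonic function `1` and `Q` the harmonic function `h`: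
up to second order `r - 1` is half of `h - 1`. -/
theorem exists_perturbation_bound {c : S → S → ℝ} (hconn : IsConnected c) {m M k : ℝ} (hm : 0 < m)
    (hk : 0 ≤ k) :
    ∃ C ε₀ : ℝ, 0 < C ∧ 0 < ε₀ ∧ ε₀ ≤ 1 ∧ ∀ (ε : ℝ) (R Q T : S → S → ℝ) (p h r l : S → ℝ) (Λ : ℝ),
      0 ≤ ε → ε ≤ ε₀ →
      (∀ x y, 0 ≤ Q x y) → (∀ x y, Q x y ≤ M) → (∀ x y, x ≠ y → c x y ≠ 0 → m ≤ Q x y) →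
      (∀ x y, 0 ≤ T x y) → (∀ x y, T x y ≤ M) → (∀ x y, x ≠ y → c x y ≠ 0 → m ≤ T x y) →
      (∀ x y, |Q x y - R x y| ≤ k * ε) → (∀ x y, |T x y - R x y| ≤ k * ε) →
      (∀ x y, |T x y - Q x y| ≤ k * ε) → (∀ x y, |T x y - (R x y + Q x y) / 2| ≤ k * ε ^ 2) →
      (∀ x, 0 ≤ p x) → ∑ x, p x = 1 → ∑ x, p x * h x = 1 → ∑ x, p x * r x = 1 →
      (∀ x, 0 < l x) →
      (∀ x, ∑ y, Q x y * h y = (∑ y, R x y) * h x) →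
      (∀ x, ∑ y, T x y * r y - (∑ y, R x y) * r x = Λ * r x) →
      (∀ y, ∑ x, l x * T x y - (∑ x, R y x) * l y = Λ * l y) →
      ∀ x, |h x - 1| ≤ C * ε ∧ |r x - 1| ≤ C * ε ∧ |(r x - 1) - (h x - 1) / 2| ≤ C * ε ^ 2 := by
  obtain ⟨C, hC, hosc⟩ := exists_oscillation_bound hconn (M := M) hm
  obtain ⟨n, hn⟩ : ∃ e : ℝ, e = (Fintype.card S : ℝ) := ⟨_, rfl⟩
  have hn0 : 0 ≤ n := hn ▸ Nat.cast_nonneg _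
  -- `C₁` will bound h - 1 at order ε, `K₂` the defect of the trial function 1 + (h - 1)/2 at order
  -- ε², `k₃` the defect of r including Λ, `C₂` bounds r - 1, and `C₃` the second-order error.
  obtain ⟨C₁, hC₁⟩ : ∃ e : ℝ, e = 2 * C * (n * k) := ⟨_, rfl⟩
  have hC₁0 : 0 ≤ C₁ := by rw [hC₁]; positivity
  obtain ⟨K₂, hK₂⟩ : ∃ e : ℝ, e = n * (k + k * C₁ / 2) := ⟨_, rfl⟩
  have hK₂0 : 0 ≤ K₂ := by rw [hK₂]; positivity
  obtain ⟨k₃, hk₃⟩ : ∃ e : ℝ, e = n * k + 2 * K₂ := ⟨_, rfl⟩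
  have hk₃0 : 0 ≤ k₃ := by rw [hk₃]; positivity
  obtain ⟨C₂, hC₂⟩ : ∃ e : ℝ, e = 2 * C * k₃ := ⟨_, rfl⟩
  have hC₂0 : 0 ≤ C₂ := by rw [hC₂]; positivity
  obtain ⟨C₃, hC₃⟩ : ∃ e : ℝ, e = C * (n * k * (C₂ + C₁ / 2) + 2 * K₂ * (1 + C₂) + K₂) := ⟨_, rfl⟩
  have hC₃0 : 0 ≤ C₃ := by rw [hC₃]; positivity
  -- This ε₀ secures at once ε ≤ 1, C k₃ ε ≤ 1/2 and C₁ ε ≤ 1.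
  refine ⟨1 + C₁ + C₂ + C₃, (1 + 2 * C * k₃ + C₁)⁻¹, by positivity, by positivity,
    inv_le_one_of_one_le₀ (by linarith), ?_⟩
  intro ε R Q T p h r l Λ hε hε₀ hQ hQM hQm hT hTM hTm hQR hTR hTQ hTRQ hp hp1 hh1 hr1 hl hh hr hlT
  have hprod : (1 + 2 * C * k₃ + C₁) * ε ≤ 1 := by
    rwa [← le_div_iff₀' (by positivity), one_div]
  have hCk₃ : 0 ≤ C * k₃ := by positivity
  have hε1 : ε ≤ 1 := by nlinarith [mul_nonneg hC₁0 hε, mul_nonneg hCk₃ hε]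
  have hs1 : C * (k₃ * ε) ≤ 1 / 2 := by nlinarith [mul_nonneg hC₁0 hε]
  have hs2 : C₁ * ε ≤ 1 := by nlinarith [mul_nonneg hCk₃ hε]
  have hs3 : C * (n * k * ε) ≤ 1 / 2 := by
    refine le_trans ?_ hs1
    have : n * k ≤ k₃ := by linarith
    gcongr
  have hsumR : ∀ x (A : S → S → ℝ) (e : ℝ), (∀ y, |A x y - R x y| ≤ e) →
      |∑ y, A x y - ∑ y, R x y| ≤ n * e := by
    intro x A e he
    rw [← Finset.sum_sub_distrib]
    rw [hn]
    exact abs_sum_le_card_mul he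
  have ha : ∀ x, |h x - 1| ≤ C₁ * ε := by
    intro x
    have := abs_sub_one_le_of_oscillation (A := Q) hp hp1 (κ := n * (k * ε)) (by positivity)
      (by rwa [← mul_assoc n]) (fun δ hδ => hosc Q h δ hQ hQM hQm hδ) hh1 (fun x => by
        have : ∑ y, Q x y * (h x - h y) = (∑ y, Q x y - ∑ y, R x y) * h x := by
          simp only [mul_sub, Finset.sum_sub_distrib, sub_mul]
          rw [hh, ← Finset.sum_mul]
        rw [this, abs_mul]
        exact mul_le_mul_of_nonneg_right (hsumR x Q _ (hQR x)) (abs_nonneg _)) x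
    rw [hC₁]
    linarith
  -- The trial function nearly solves the equation for T: halving R1 = λ1 and Qh = λh and adding
  -- cancels all but T - (R + Q)/2 and (T - Q)(h - 1)/2, both of order ε².
  have hLu : ∀ x, |∑ y, T x y * (1 + (h y - 1) / 2) - (∑ y, R x y) * (1 + (h x - 1) / 2)| ≤
      K₂ * ε ^ 2 := by
    intro x
    have h1 : ∑ y, T x y * (1 + (h y - 1) / 2) - (∑ y, R x y) * (1 + (h x - 1) / 2) =
        ∑ y, ((T x y - (R x y + Q x y) / 2) + (T x y - Q x y) * (h y - 1) / 2) := by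
      have h2 : (∑ y, R x y) * (1 + (h x - 1) / 2) =
          ∑ y, (R x y / 2 + Q x y * h y / 2) := by
        rw [Finset.sum_add_distrib, ← Finset.sum_div, ← Finset.sum_div, hh]
        ring
      rw [h2, ← Finset.sum_sub_distrib]
      exact Finset.sum_congr rfl fun y _ => by ring
    rw [h1, hK₂, mul_assoc, hn]
    refine abs_sum_le_card_mul fun y => (abs_add_le _ _).trans ?_
    rw [abs_div, abs_mul, abs_two]
    have := mul_le_mul (hTQ x y) (ha y) (abs_nonneg _) (by positivity)
    have := hTRQ x y
    nlinarith
  -- Pairing the trial function with the left eigenvector l isolates Λ; the trial function is at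
  -- least 1/2, so no quantitative control on l is needed.
  have hΛ : |Λ| ≤ 2 * K₂ * ε ^ 2 := by
    rcases isEmpty_or_nonempty S with hS | ⟨⟨x₀⟩⟩
    · simp at hp1
    have hpair : Λ * ∑ y, l y * (1 + (h y - 1) / 2) = ∑ x, l x *
        (∑ y, T x y * (1 + (h y - 1) / 2) - (∑ y, R x y) * (1 + (h x - 1) / 2)) := by
      have e : ∀ x, l x *
          (∑ y, T x y * (1 + (h y - 1) / 2) - (∑ y, R x y) * (1 + (h x - 1) / 2)) =
          ∑ y, l x * T x y * (1 + (h y - 1) / 2) -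
            (∑ y, R x y) * l x * (1 + (h x - 1) / 2) := fun x => by
        rw [mul_sub, Finset.mul_sum]
        congr 1
        · exact Finset.sum_congr rfl fun y _ => by ring
        · ring
      simp only [e, Finset.sum_sub_distrib]
      rw [Finset.sum_comm, ← Finset.sum_sub_distrib, Finset.mul_sum]
      refine Finset.sum_congr rfl fun y _ => ?_
      rw [← Finset.sum_mul, ← mul_assoc, ← hlT]
      ring
    have hlpos : 0 < ∑ y, l y := Finset.sum_pos (fun y _ => hl y) ⟨x₀, Finset.mem_univ _⟩
    have hlow : (∑ y, l y) / 2 ≤ ∑ y, l y * (1 + (h y - 1) / 2) := by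
      rw [Finset.sum_div]
      refine Finset.sum_le_sum fun y _ => ?_
      have h1 := (abs_le.1 ((ha y).trans hs2)).1
      rw [div_eq_mul_inv]
      exact mul_le_mul_of_nonneg_left (by linarith) (hl y).le
    have hup : |Λ * ∑ y, l y * (1 + (h y - 1) / 2)| ≤ (∑ y, l y) * (K₂ * ε ^ 2) := by
      rw [hpair, Finset.sum_mul]
      refine (Finset.abs_sum_le_sum_abs _ _).trans (Finset.sum_le_sum fun x _ => ?_)
      rw [abs_mul, abs_of_pos (hl x)]
      exact mul_le_mul_of_nonneg_left (hLu x) (hl x).le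
    rw [abs_mul] at hup
    have h3 : |Λ| * ((∑ y, l y) / 2) ≤ (∑ y, l y) * (K₂ * ε ^ 2) :=
      (mul_le_mul_of_nonneg_left (hlow.trans (le_abs_self _)) (abs_nonneg _)).trans hup
    refine le_of_mul_le_mul_right ?_ hlpos
    linarith
  have hb : ∀ x, |r x - 1| ≤ C₂ * ε := by
    intro x
    have := abs_sub_one_le_of_oscillation (A := T) hp hp1 (κ := k₃ * ε) (by positivity)
      hs1 (fun δ hδ => hosc T r δ hT hTM hTm hδ) hr1 (fun x => by
        have : ∑ y, T x y * (r x - r y) = ((∑ y, T x y - ∑ y, R x y) - Λ) * r x := by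
          simp only [mul_sub, Finset.sum_sub_distrib, sub_mul]
          rw [← hr, ← Finset.sum_mul]
          ring
        rw [this, abs_mul]
        refine mul_le_mul_of_nonneg_right ((abs_sub _ _).trans ?_) (abs_nonneg _)
        have h1 := hsumR x T _ (hTR x)
        have h2 : ε ^ 2 ≤ ε := by nlinarith
        have h3 := mul_le_mul_of_nonneg_left h2 (by positivity : 0 ≤ 2 * K₂)
        rw [hk₃]
        linarith) x
    rw [hC₂]
    linarith
  -- The difference of r and the trial function has p-mean zero, and its defect for T is of order
  -- ε²: a row-sum error O(ε) times an O(ε) function, the term Λ r, and the defect from `hLu`.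
  have hd : ∀ x, |(r x - 1) - (h x - 1) / 2| ≤ C₃ * ε ^ 2 := by
    intro x
    have hmean : ∑ y, p y * ((r y - 1) - (h y - 1) / 2) = 0 := by
      have : ∀ y, p y * ((r y - 1) - (h y - 1) / 2) = p y * r y - p y * h y / 2 - p y / 2 :=
        fun y => by ring
      simp only [this, Finset.sum_sub_distrib, ← Finset.sum_div, hp1, hr1, hh1]
      norm_num
    have h1 := abs_sub_mean_le hp hp1 (hosc T (fun x => (r x - 1) - (h x - 1) / 2)
      ((n * k * (C₂ + C₁ / 2) + 2 * K₂ * (1 + C₂) + K₂) * ε ^ 2) hT hTM hTm (by positivity)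
      fun x => by
        have e1 : ∑ y, T x y * (((r x - 1) - (h x - 1) / 2) - ((r y - 1) - (h y - 1) / 2)) =
            (∑ y, T x y - ∑ y, R x y) * ((r x - 1) - (h x - 1) / 2) - Λ * r x +
            (∑ y, T x y * (1 + (h y - 1) / 2) - (∑ y, R x y) * (1 + (h x - 1) / 2)) := by
          have e2 : ∀ y, T x y * (((r x - 1) - (h x - 1) / 2) - ((r y - 1) - (h y - 1) / 2)) =
              T x y * ((r x - 1) - (h x - 1) / 2) - T x y * r y + T x y * (1 + (h y - 1) / 2) :=
            fun y => by ring
          simp only [e2, Finset.sum_add_distrib, Finset.sum_sub_distrib]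
          rw [← hr, ← Finset.sum_mul]
          ring
        rw [e1]
        have f1 : |(r x - 1) - (h x - 1) / 2| ≤ C₂ * ε + C₁ * ε / 2 := by
          refine (abs_sub _ _).trans ?_
          rw [abs_div, abs_two]
          linarith [ha x, hb x]
        have f2 : |r x| ≤ 1 + C₂ := by
          have g1 : |r x| ≤ |r x - 1| + |(1 : ℝ)| := by
            simpa using abs_add_le (r x - 1) 1
          have g2 := mul_le_mul_of_nonneg_left hε1 hC₂0
          rw [abs_one] at g1
          linarith [hb x]
        have f3 := mul_le_mul (hsumR x T _ (hTR x)) f1 (abs_nonneg _) (by positivity)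
        have f4 := mul_le_mul hΛ f2 (abs_nonneg _) (by positivity)
        rw [← abs_mul] at f3 f4
        refine (abs_add_le _ _).trans ((add_le_add_left (abs_sub _ _) _).trans ?_)
        have f5 := hLu x
        linarith) x
    rw [hmean, sub_zero, ← mul_assoc] at h1
    rwa [hC₃]
  intro x
  refine ⟨(ha x).trans ?_, (hb x).trans ?_, (hd x).trans ?_⟩ <;>
  · gcongr
    linarith

theorem abs_log_one_add_sub_le {z : ℝ} (hz : |z| ≤ 1 / 2) : |Real.log (1 + z) - z| ≤ 2 * z ^ 2 := by
  have h := Real.abs_log_sub_add_sum_range_le (x := -z) (by rw [abs_neg]; linarith) 1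
  simp only [Finset.sum_range_one, abs_neg, sub_neg_eq_add] at h
  have h2 : |z| ^ (1 + 1) / (1 - |z|) ≤ 2 * z ^ 2 := by
    norm_num only
    rw [div_le_iff₀ (by linarith), ← sq_abs z]
    nlinarith [mul_nonneg (sq_nonneg |z|) (sub_nonneg.2 hz)]
  refine le_trans (le_of_eq ?_) (h.trans h2)
  congr 1
  norm_num
  ring

theorem abs_log_one_add_sub_sub_le {z : ℝ} (hz : |z| ≤ 1 / 2) :
    |Real.log (1 + z) - (z - z ^ 2 / 2)| ≤ 2 * |z| ^ 3 := by
  have h := Real.abs_log_sub_add_sum_range_le (x := -z) (by rw [abs_neg]; linarith) 2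
  simp only [Finset.sum_range_succ, Finset.sum_range_zero, abs_neg, sub_neg_eq_add] at h
  have h2 : |z| ^ (2 + 1) / (1 - |z|) ≤ 2 * |z| ^ 3 := by
    norm_num only
    rw [div_le_iff₀ (by linarith)]
    nlinarith [mul_nonneg (pow_nonneg (abs_nonneg z) 3) (sub_nonneg.2 hz)]
  refine le_trans (le_of_eq ?_) (h.trans h2)
  congr 1
  norm_num
  ring

/-- The difference of the two entropies in terms of the densities `h` and `r`. -/
noncomputable def entropyGap (star : S → S) (p h r : S → ℝ) : ℝ :=
  -Real.log (∑ x, p x * h (star x) * r x) +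
    (∑ x, p x * h (star x) * (Real.log (h x) + Real.log (h (star x)))) / 2

/-- With a = h - 1 and b = r - 1, the logarithm contributes -∑ p a(x*) b and the second term ½ ∑ p
a(x*) a, up to order ε³. They cancel to that order because b is a/2 up to ε². -/
theorem abs_entropyGap_le {star : S → S} (hstar : Function.Involutive star) {p h r : S → ℝ}
    {C ε : ℝ} (hC : 0 ≤ C) (hε : 0 ≤ ε) (hε1 : ε ≤ 1) (hCε : C * ε ≤ 1 / 2)
    (hp : ∀ x, 0 ≤ p x) (hp1 : ∑ x, p x = 1) (hps : ∀ x, p (star x) = p x)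
    (hh1 : ∑ x, p x * h x = 1) (hr1 : ∑ x, p x * r x = 1)
    (hh : ∀ x, |h x - 1| ≤ C * ε) (hr : ∀ x, |r x - 1| ≤ C * ε)
    (hd : ∀ x, |(r x - 1) - (h x - 1) / 2| ≤ C * ε ^ 2) :
    |entropyGap star p h r| ≤ (4 * C ^ 3 + 2 * C ^ 4 + C ^ 2) * ε ^ 3 := by
  set a : S → ℝ := fun x => h x - 1 with ha
  set b : S → ℝ := fun x => r x - 1 with hb
  have hah : ∀ x, h x = 1 + a x := fun x => by simp [ha]
  have hbr : ∀ x, r x = 1 + b x := fun x => by simp [hb]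
  have hsum_star : ∀ f : S → ℝ, ∑ x, p x * f (star x) = ∑ x, p x * f x := by
    intro f
    rw [← Equiv.sum_comp (hstar.toPerm star) fun x => p x * f x]
    exact Finset.sum_congr rfl fun x _ => by simp [hps]
  have ha0 : ∑ x, p x * a x = 0 := by
    simp only [ha, mul_sub, mul_one, Finset.sum_sub_distrib, hh1, hp1, sub_self]
  have hb0 : ∑ x, p x * b x = 0 := by
    simp only [hb, mul_sub, mul_one, Finset.sum_sub_distrib, hr1, hp1, sub_self]
  set z := ∑ x, p x * (a (star x) * b x) with hz
  have hz1 : ∑ x, p x * h (star x) * r x = 1 + z := by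
    have : ∀ x, p x * h (star x) * r x =
        p x + p x * a (star x) + p x * b x + p x * (a (star x) * b x) := fun x => by
      rw [hah, hbr]; ring
    simp only [this, Finset.sum_add_distrib, hsum_star, ha0, hb0, hp1, hz]
    ring
  have hCε0 : 0 ≤ C * ε := by positivity
  have hzle : |z| ≤ (C * ε) ^ 2 := by
    refine abs_weightedSum_le hp hp1 fun x => ?_
    rw [abs_mul, sq]
    exact mul_le_mul (hh _) (hr _) (abs_nonneg _) hCε0
  have hz2 : |Real.log (1 + z) - z| ≤ 2 * C ^ 4 * ε ^ 3 := by
    refine (abs_log_one_add_sub_le (hzle.trans (by nlinarith))).trans ?_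
    have h1 : z ^ 2 ≤ ((C * ε) ^ 2) ^ 2 := by
      rw [← sq_abs z]
      exact pow_le_pow_left₀ (abs_nonneg _) hzle 2
    have h2 : ε ^ 4 ≤ ε ^ 3 := pow_le_pow_of_le_one hε hε1 (by norm_num)
    have h3 := mul_le_mul_of_nonneg_left h2 (by positivity : 0 ≤ 2 * C ^ 4)
    calc 2 * z ^ 2 ≤ 2 * C ^ 4 * ε ^ 4 := by linarith
      _ ≤ _ := h3
  set q := ∑ x, p x * (a (star x) * a x) with hq
  have hquad : |(∑ x, p x * h (star x) * (Real.log (h x) + Real.log (h (star x)))) - q| ≤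
      7 * (C * ε) ^ 3 := by
    -- The bracket is the second-order Taylor polynomial of the summand. Under the star-invariant p
    -- its linear terms have mean zero and its two squares cancel.
    have e1 : q = ∑ x, p x * (a x + a (star x) + (a (star x) ^ 2 - a x ^ 2) / 2 +
        a (star x) * a x) := by
      have e2 : ∀ x, p x * (a x + a (star x) + (a (star x) ^ 2 - a x ^ 2) / 2 +
          a (star x) * a x) = p x * a x + p x * a (star x) + p x * a (star x) ^ 2 / 2 -
            p x * a x ^ 2 / 2 + p x * (a (star x) * a x) := fun x => by ring
      simp only [e2, Finset.sum_add_distrib, Finset.sum_sub_distrib, ← Finset.sum_div]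
      rw [hsum_star a, hsum_star fun x => a x ^ 2, ha0, hq]
      ring
    rw [e1, ← Finset.sum_sub_distrib]
    simp only [mul_assoc, ← mul_sub]
    refine abs_weightedSum_le hp hp1 fun x => ?_
    have g : ∀ x, |Real.log (h x) - (a x - a x ^ 2 / 2)| ≤ 2 * (C * ε) ^ 3 := fun x => by
      rw [hah]
      refine (abs_log_one_add_sub_sub_le ((hh x).trans hCε)).trans ?_
      have := pow_le_pow_left₀ (abs_nonneg _) (hh x) 3
      linarith
    have e3 : h (star x) * (Real.log (h x) + Real.log (h (star x))) -
        (a x + a (star x) + (a (star x) ^ 2 - a x ^ 2) / 2 + a (star x) * a x) =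
        h (star x) * ((Real.log (h x) - (a x - a x ^ 2 / 2)) +
          (Real.log (h (star x)) - (a (star x) - a (star x) ^ 2 / 2))) -
          a (star x) * (a x ^ 2 + a (star x) ^ 2) / 2 := by
      rw [hah (star x)]
      ring
    rw [e3]
    have g1 : |h (star x)| ≤ 3 / 2 := by
      have := abs_le.1 ((hh (star x)).trans hCε)
      exact abs_le.2 ⟨by linarith, by linarith⟩
    have g2 : |(Real.log (h x) - (a x - a x ^ 2 / 2)) +
          (Real.log (h (star x)) - (a (star x) - a (star x) ^ 2 / 2))| ≤ 4 * (C * ε) ^ 3 :=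
      (abs_add_le _ _).trans (by linarith [g x, g (star x)])
    have g3 := mul_le_mul g1 g2 (abs_nonneg _) (by norm_num)
    rw [← abs_mul] at g3
    have g4 : |a (star x) * (a x ^ 2 + a (star x) ^ 2) / 2| ≤ (C * ε) ^ 3 := by
      have i1 : ∀ x, a x ^ 2 ≤ (C * ε) ^ 2 := fun x => by
        rw [← sq_abs]
        exact pow_le_pow_left₀ (abs_nonneg _) (hh x) 2
      have i2 : |a x ^ 2 + a (star x) ^ 2| ≤ 2 * (C * ε) ^ 2 := by
        rw [abs_of_nonneg (by positivity)]
        linarith [i1 x, i1 (star x)]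
      have i3 := mul_le_mul (hh (star x)) i2 (abs_nonneg _) hCε0
      rw [abs_div, abs_two, abs_mul]
      change |a (star x)| * _ ≤ _ at i3
      linarith
    exact (abs_sub _ _).trans (by linarith)
  -- The one place where the second-order relation between r and h enters.
  have hlin : |q / 2 - z| ≤ C ^ 2 * ε ^ 3 := by
    have e1 : q / 2 - z = ∑ x, p x * -(a (star x) * (b x - a x / 2)) := by
      rw [hq, hz, Finset.sum_div, ← Finset.sum_sub_distrib]
      exact Finset.sum_congr rfl fun x _ => by ring
    rw [e1]
    refine abs_weightedSum_le hp hp1 fun x => ?_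
    rw [abs_neg, abs_mul]
    calc _ ≤ C * ε * (C * ε ^ 2) := mul_le_mul (hh _) (hd x) (abs_nonneg _) hCε0
      _ = _ := by ring
  rw [entropyGap, hz1]
  set L := ∑ x, p x * h (star x) * (Real.log (h x) + Real.log (h (star x)))
  have e : -Real.log (1 + z) + L / 2 = -(Real.log (1 + z) - z) + (L - q) / 2 + (q / 2 - z) := by
    ring
  rw [e]
  refine (abs_add_le _ _).trans ((add_le_add_left (abs_add_le _ _) _).trans ?_)
  rw [abs_neg, abs_div, abs_two]
  have : 0 ≤ C ^ 3 * ε ^ 3 := by positivity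
  nlinarith

/-- The weights p(x) h(x*) form a probability vector, so the gap consists of the logarithm of an
average of r and an average of logarithms of h. -/
theorem abs_entropyGap_le_of_log {star : S → S} (hstar : Function.Involutive star)
    {p h r : S → ℝ} {t : ℝ}
    (hp : ∀ x, 0 ≤ p x) (hps : ∀ x, p (star x) = p x)
    (hh1 : ∑ x, p x * h x = 1) (hh0 : ∀ x, 0 < h x) (hr0 : ∀ x, 0 < r x)
    (hh : ∀ x, |Real.log (h x)| ≤ t) (hr : ∀ x, |Real.log (r x)| ≤ t) :
    |entropyGap star p h r| ≤ 2 * t := by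
  have hw : ∀ x, 0 ≤ p x * h (star x) := fun x => mul_nonneg (hp x) (hh0 _).le
  have hw1 : ∑ x, p x * h (star x) = 1 := by
    rw [← hh1, ← Equiv.sum_comp (hstar.toPerm star) fun x => p x * h x]
    exact Finset.sum_congr rfl fun x _ => by simp [hps]
  have hrt : ∀ x, Real.exp (-t) ≤ r x ∧ r x ≤ Real.exp t := fun x =>
    ⟨(Real.le_log_iff_exp_le (hr0 x)).1 (abs_le.1 (hr x)).1,
      (Real.log_le_iff_le_exp (hr0 x)).1 (abs_le.1 (hr x)).2⟩
  have hlow : Real.exp (-t) ≤ ∑ x, p x * h (star x) * r x := by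
    calc Real.exp (-t) = ∑ x, p x * h (star x) * Real.exp (-t) := by
          rw [← Finset.sum_mul, hw1, one_mul]
      _ ≤ _ := Finset.sum_le_sum fun x _ => mul_le_mul_of_nonneg_left (hrt x).1 (hw x)
  have hup : ∑ x, p x * h (star x) * r x ≤ Real.exp t := by
    calc _ ≤ ∑ x, p x * h (star x) * Real.exp t :=
          Finset.sum_le_sum fun x _ => mul_le_mul_of_nonneg_left (hrt x).2 (hw x)
      _ = _ := by rw [← Finset.sum_mul, hw1, one_mul]
  have hpos := (Real.exp_pos (-t)).trans_le hlow
  have h1 : |Real.log (∑ x, p x * h (star x) * r x)| ≤ t :=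
    abs_le.2 ⟨(Real.le_log_iff_exp_le hpos).2 hlow, (Real.log_le_iff_le_exp hpos).2 hup⟩
  have h2 : |∑ x, p x * h (star x) * (Real.log (h x) + Real.log (h (star x)))| ≤ 2 * t :=
    abs_weightedSum_le hw hw1 fun x =>
      (abs_add_le _ _).trans (by linarith [hh x, hh (star x)])
  rw [entropyGap]
  refine (abs_add_le _ _).trans ?_
  rw [abs_neg, abs_div, abs_two]
  linarith

/-- A Harnack inequality along chains, uniform in the function. -/
theorem exists_harnack_exponent {c : S → S → ℝ} (hconn : IsConnected c) :
    ∃ N : ℕ, ∀ (B : ℝ) (v : S → ℝ), 1 ≤ B → (∀ x, 0 < v x) →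
      (∀ x y, x ≠ y → c x y ≠ 0 → v y ≤ B * v x) → ∀ x y, v y ≤ B ^ N * v x := by
  have hex : ∀ x y, ∃ N : ℕ, ∀ (B : ℝ) (v : S → ℝ), 1 ≤ B → (∀ x, 0 < v x) →
      (∀ x y, x ≠ y → c x y ≠ 0 → v y ≤ B * v x) → v y ≤ B ^ N * v x := by
    intro x y
    induction hconn x y with
    | refl => exact ⟨0, fun B v _ _ _ => by simp⟩
    | @tail y z _ hyz ih =>
      obtain ⟨N, h⟩ := ih
      refine ⟨N + 1, fun B v hB hv he => (he y z hyz.1 hyz.2).trans ?_⟩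
      rw [pow_succ', mul_assoc]
      exact mul_le_mul_of_nonneg_left (h B v hB hv he) (by linarith)
  choose N hN using hex
  refine ⟨∑ x, ∑ y, N x y, fun B v hB hv he x y => (hN x y B v hB hv he).trans ?_⟩
  refine mul_le_mul_of_nonneg_right (pow_le_pow_right₀ hB ?_) (hv x).le
  exact (Finset.single_le_sum (f := fun y => N x y) (fun _ _ => Nat.zero_le _)
    (Finset.mem_univ y)).trans (Finset.single_le_sum (f := fun x => ∑ y, N x y)
    (fun _ _ => Nat.zero_le _) (Finset.mem_univ x))

/-- A positive function of mean 1 whose values are comparable within a factor B ^ N lies between B ^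
(-N) and B ^ N. -/
theorem abs_log_le_of_harnack {p v : S → ℝ} {B : ℝ} {N : ℕ} (hp : ∀ x, 0 ≤ p x)
    (hp1 : ∑ x, p x = 1) (hv1 : ∑ x, p x * v x = 1) (hB : 0 < B) (hv : ∀ x, 0 < v x)
    (h : ∀ x y, v y ≤ B ^ N * v x) (x : S) : |Real.log (v x)| ≤ N * Real.log B := by
  have hBN : 0 < B ^ N := pow_pos hB N
  have h1 : v x ≤ B ^ N := by
    calc v x = ∑ y, p y * v x := by rw [← Finset.sum_mul, hp1, one_mul]
      _ ≤ ∑ y, p y * (B ^ N * v y) :=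
          Finset.sum_le_sum fun y _ => mul_le_mul_of_nonneg_left (h y x) (hp y)
      _ = B ^ N := by
          simp only [mul_left_comm (p _)]
          rw [← Finset.mul_sum, hv1, mul_one]
  have h2 : 1 ≤ B ^ N * v x := by
    calc 1 = ∑ y, p y * v y := hv1.symm
      _ ≤ ∑ y, p y * (B ^ N * v x) :=
          Finset.sum_le_sum fun y _ => mul_le_mul_of_nonneg_left (h x y) (hp y)
      _ = _ := by rw [← Finset.sum_mul, hp1, one_mul]
  have h3 := Real.log_le_log (hv x) h1
  have h4 := Real.log_nonneg h2
  rw [Real.log_mul hBN.ne' (hv x).ne'] at h4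
  rw [Real.log_pow] at h3 h4
  exact abs_le.2 ⟨by linarith, h3⟩

end Estimates

/-! ### The cubic bound on the entropy gap for all ε -/

section EntropyGap

variable {S : Type*} [Fintype S]

theorem exists_pos_lower_bound (P : S → S → Prop) {c : S → S → ℝ} (hc : ∀ x y, P x y → 0 < c x y) :
    ∃ m : ℝ, 0 < m ∧ ∀ x y, P x y → m ≤ c x y := by
  have hpos : 0 < 1 + ∑ x, ∑ y, |(c x y)⁻¹| := by positivity
  refine ⟨(1 + ∑ x, ∑ y, |(c x y)⁻¹|)⁻¹, inv_pos.2 hpos, fun x y h => ?_⟩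
  rw [inv_le_comm₀ hpos (hc x y h)]
  have h1 := Finset.single_le_sum (f := fun y => |(c x y)⁻¹|) (fun _ _ => abs_nonneg _)
    (Finset.mem_univ y)
  have h2 := Finset.single_le_sum (f := fun x => ∑ y, |(c x y)⁻¹|)
    (fun _ _ => Finset.sum_nonneg fun _ _ => abs_nonneg _) (Finset.mem_univ x)
  have h3 := le_abs_self (c x y)⁻¹
  linarith

theorem abs_exp_sub_exp_le {s t ε : ℝ} (hε1 : ε ≤ 1) (hs : |s| ≤ ε) (ht : |t| ≤ ε) :
    |Real.exp s - Real.exp t| ≤ 4 * ε := by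
  have h1 := Real.abs_exp_sub_one_le (hs.trans hε1)
  have h2 := Real.abs_exp_sub_one_le (ht.trans hε1)
  have h3 : Real.exp s - Real.exp t = (Real.exp s - 1) - (Real.exp t - 1) := by ring
  rw [h3]
  exact (abs_sub _ _).trans (by linarith)

/-- The geometric and arithmetic means of exp s and exp t agree to first order; this is why T is (R
+ Q)/2 up to ε². -/
theorem abs_exp_midpoint_sub_le {s t ε : ℝ} (hε1 : ε ≤ 1) (hs : |s| ≤ ε)
    (ht : |t| ≤ ε) :
    |Real.exp ((s + t) / 2) - (Real.exp s + Real.exp t) / 2| ≤ 2 * ε ^ 2 := by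
  have hm : |(s + t) / 2| ≤ ε := by
    rw [abs_div, abs_two]
    linarith [abs_add_le s t]
  have key : ∀ u : ℝ, |u| ≤ ε → |Real.exp u - 1 - u| ≤ ε ^ 2 := fun u hu => by
    refine (Real.abs_exp_sub_one_sub_id_le (hu.trans hε1)).trans ?_
    rw [← sq_abs]
    exact pow_le_pow_left₀ (abs_nonneg _) hu 2
  have h1 := abs_le.1 (key _ hm)
  have h2 := abs_le.1 (key _ hs)
  have h3 := abs_le.1 (key _ ht)
  exact abs_le.2 ⟨by linarith, by linarith⟩

/-- The equation at a maximum of v gives Λ ≤ G; at x it then bounds the single term A x y v y by 2G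
v x. -/
theorem harnack_eigenvector {A : S → S → ℝ} {lam v : S → ℝ} {Λ G g : ℝ} (hA : ∀ x y, 0 ≤ A x y)
    (hv : ∀ x, 0 < v x) (hlam : ∀ x, 0 ≤ lam x) (hlamG : ∀ x, lam x ≤ G)
    (hAG : ∀ x, ∑ y, A x y ≤ G) (hg : 0 < g)
    (h : ∀ x, ∑ y, A x y * v y - lam x * v x = Λ * v x) {x y : S} (hxy : g ≤ A x y) :
    v y ≤ 2 * G / g * v x := by
  obtain ⟨z, -, hz⟩ := Finset.exists_max_image Finset.univ v ⟨x, Finset.mem_univ x⟩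
  have h1 : ∑ y, A z y * v y ≤ G * v z := by
    calc _ ≤ ∑ y, A z y * v z := Finset.sum_le_sum fun y _ =>
          mul_le_mul_of_nonneg_left (hz y (Finset.mem_univ y)) (hA z y)
      _ ≤ _ := by
          rw [← Finset.sum_mul]
          exact mul_le_mul_of_nonneg_right (hAG z) (hv z).le
  have hΛ : Λ ≤ G := by
    refine le_of_mul_le_mul_right ?_ (hv z)
    have := mul_nonneg (hlam z) (hv z).le
    linarith [h z]
  have h2 : A x y * v y ≤ ∑ y, A x y * v y :=
    Finset.single_le_sum (f := fun y => A x y * v y)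
      (fun w _ => mul_nonneg (hA x w) (hv w).le) (Finset.mem_univ y)
  have h3 : g * v y ≤ A x y * v y := mul_le_mul_of_nonneg_right hxy (hv y).le
  have h4 : (Λ + lam x) * v x ≤ 2 * G * v x :=
    mul_le_mul_of_nonneg_right (by linarith [hlamG x]) (hv x).le
  rw [div_mul_eq_mul_div, le_div_iff₀' hg]
  linarith [h x]

set_option maxHeartbeats 1000000 in
-- Here B stands for the equilibrium rates and X, Y for ξ(x,y) and ξ(y*,x*). Perturbation theory
-- covers ε ≤ ε₁ and Harnack bounds cover ε ≥ ε₁.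
theorem exists_entropyGap_bound {star : S → S} (hstar : Function.Involutive star)
    {c : S → S → ℝ} (hc : ∀ x y, x ≠ y → 0 ≤ c x y) (hconn : IsConnected c) (K : ℝ) :
    ∃ A' : ℝ, 0 < A' ∧ ∀ (ε : ℝ) (B X Y : S → S → ℝ) (p h r l : S → ℝ) (Λ : ℝ), 0 ≤ ε →
      (∀ x, B x x = 0) → (∀ x y, 0 ≤ B x y) →
      (∀ x y, x ≠ y → Real.exp (-K) * c x y ≤ B x y) →
      (∀ x y, x ≠ y → B x y ≤ Real.exp K * c x y) →
      (∀ x y, B x y ≠ 0 → |X x y| ≤ 1) → (∀ x y, B x y ≠ 0 → |Y x y| ≤ 1) →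
      (∀ x, 0 ≤ p x) → ∑ x, p x = 1 → (∀ x, p (star x) = p x) →
      ∑ x, p x * h x = 1 → ∑ x, p x * r x = 1 →
      (∀ x, 0 < h x) → (∀ x, 0 < r x) → (∀ x, 0 < l x) →
      (∀ x, ∑ y, Real.exp (ε * Y x y) * B x y * h y =
        (∑ y, Real.exp (ε * X x y) * B x y) * h x) →
      (∀ x, ∑ y, Real.exp ((ε * X x y + ε * Y x y) / 2) * B x y * r y -
        (∑ y, Real.exp (ε * X x y) * B x y) * r x = Λ * r x) →
      (∀ y, ∑ x, l x * (Real.exp ((ε * X x y + ε * Y x y) / 2) * B x y) -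
        (∑ x, Real.exp (ε * X y x) * B y x) * l y = Λ * l y) →
      |entropyGap star p h r| ≤ A' * ε ^ 3 := by
  obtain ⟨m₀, hm₀, hcm⟩ := exists_pos_lower_bound (fun x y => x ≠ y ∧ c x y ≠ 0) (c := c)
    fun x y hxy => lt_of_le_of_ne (hc x y hxy.1) (Ne.symm hxy.2)
  obtain ⟨D, hD⟩ : ∃ D : ℝ, D = Real.exp K * ∑ x, ∑ y, |c x y| := ⟨_, rfl⟩
  have hD0 : 0 ≤ D := by rw [hD]; positivity
  obtain ⟨C, ε₀, hC, hε₀, hε₀1, hpert⟩ := exists_perturbation_bound hconn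
    (m := Real.exp (-1) * (Real.exp (-K) * m₀)) (M := Real.exp 1 * D) (k := 4 * D)
    (by positivity) (by positivity)
  obtain ⟨N, hN⟩ := exists_harnack_exponent hconn
  -- `k₁` is 1 plus the Harnack ratio 2G/g at ε = 0; tilting by exp(±ε) costs at most a further
  -- factor exp(2ε).
  obtain ⟨k₁, hk₁⟩ : ∃ k₁ : ℝ, k₁ = 1 + 2 * (Fintype.card S * D) / (Real.exp (-K) * m₀) := ⟨_, rfl⟩
  have hk₁1 : 1 ≤ k₁ := by
    rw [hk₁]
    have : 0 ≤ 2 * (Fintype.card S * D) / (Real.exp (-K) * m₀) := by positivity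
    linarith
  have hlogk₁ : 0 ≤ Real.log k₁ := Real.log_nonneg hk₁1
  obtain ⟨ε₁, hε₁⟩ : ∃ ε₁ : ℝ, ε₁ = min ε₀ (1 / (2 * C)) := ⟨_, rfl⟩
  have hε₁0 : 0 < ε₁ := by rw [hε₁]; exact lt_min hε₀ (by positivity)
  refine ⟨(4 * C ^ 3 + 2 * C ^ 4 + C ^ 2) + 2 * (N * (Real.log k₁ + 2)) / ε₁ ^ 3, by positivity, ?_⟩
  intro ε B X Y p h r l Λ hε hBd hB hBl hBu hX hY hp hp1 hps hh1 hr1 hh0 hr0 hl hh hr hlT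
  have hBD : ∀ x y, B x y ≤ D := by
    intro x y
    by_cases hxy : x = y
    · rw [hxy, hBd]; exact hD0
    · refine (hBu x y hxy).trans ?_
      rw [hD]
      refine mul_le_mul_of_nonneg_left ((le_abs_self _).trans ?_) (Real.exp_pos _).le
      exact (Finset.single_le_sum (f := fun y => |c x y|) (fun _ _ => abs_nonneg _)
        (Finset.mem_univ y)).trans (Finset.single_le_sum (f := fun x => ∑ y, |c x y|)
        (fun _ _ => Finset.sum_nonneg fun _ _ => abs_nonneg _) (Finset.mem_univ x))
  have hBm : ∀ x y, x ≠ y → c x y ≠ 0 → Real.exp (-K) * m₀ ≤ B x y := fun x y h1 h2 =>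
    (mul_le_mul_of_nonneg_left (hcm x y ⟨h1, h2⟩) (Real.exp_pos _).le).trans (hBl x y h1)
  have hX' : ∀ x y, B x y ≠ 0 → |ε * X x y| ≤ ε := fun x y hb => by
    rw [abs_mul, abs_of_nonneg hε]
    exact mul_le_of_le_one_right hε (hX x y hb)
  have hY' : ∀ x y, B x y ≠ 0 → |ε * Y x y| ≤ ε := fun x y hb => by
    rw [abs_mul, abs_of_nonneg hε]
    exact mul_le_of_le_one_right hε (hY x y hb)
  have hZ' : ∀ x y, B x y ≠ 0 → |(ε * X x y + ε * Y x y) / 2| ≤ ε := fun x y hb => by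
    rw [abs_div, abs_two]
    linarith [abs_add_le (ε * X x y) (ε * Y x y), hX' x y hb, hY' x y hb]
  have hup : ∀ (Z : S → S → ℝ), (∀ x y, B x y ≠ 0 → |Z x y| ≤ ε) →
      ∀ x y, Real.exp (Z x y) * B x y ≤ Real.exp ε * D := by
    intro Z hZ x y
    by_cases hb : B x y = 0
    · rw [hb, mul_zero]; positivity
    · exact mul_le_mul (Real.exp_le_exp.2 (abs_le.1 (hZ x y hb)).2) (hBD x y) (hB x y)
        (Real.exp_pos _).le
  have hlow : ∀ (Z : S → S → ℝ), (∀ x y, B x y ≠ 0 → |Z x y| ≤ ε) →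
      ∀ x y, x ≠ y → c x y ≠ 0 →
        Real.exp (-ε) * (Real.exp (-K) * m₀) ≤ Real.exp (Z x y) * B x y := by
    intro Z hZ x y h1 h2
    have hb := hBm x y h1 h2
    have hb0 : B x y ≠ 0 := ((by positivity : 0 < Real.exp (-K) * m₀).trans_le hb).ne'
    exact mul_le_mul (Real.exp_le_exp.2 (abs_le.1 (hZ x y hb0)).1) hb (by positivity)
      (Real.exp_pos _).le
  have hnn : ∀ (Z : S → S → ℝ) x y, 0 ≤ Real.exp (Z x y) * B x y := fun Z x y =>
    mul_nonneg (Real.exp_pos _).le (hB x y)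
  rcases le_total ε ε₁ with hle | hge
  · have hεε₀ : ε ≤ ε₀ := hle.trans (hε₁ ▸ min_le_left _ _)
    have hε1 : ε ≤ 1 := hεε₀.trans hε₀1
    have hCε : C * ε ≤ 1 / 2 := by
      have : ε ≤ 1 / (2 * C) := hle.trans (hε₁ ▸ min_le_right _ _)
      rw [le_div_iff₀ (by positivity)] at this
      linarith
    have hexp1 : Real.exp ε * D ≤ Real.exp 1 * D :=
      mul_le_mul_of_nonneg_right (Real.exp_le_exp.2 hε1) hD0
    have hexpm1 : Real.exp (-1) * (Real.exp (-K) * m₀) ≤ Real.exp (-ε) * (Real.exp (-K) * m₀) :=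
      mul_le_mul_of_nonneg_right (Real.exp_le_exp.2 (by linarith)) (by positivity)
    have hdiff : ∀ Z Z' : S → S → ℝ, (∀ x y, B x y ≠ 0 → |Z x y| ≤ ε) →
        (∀ x y, B x y ≠ 0 → |Z' x y| ≤ ε) →
        ∀ x y, |Real.exp (Z x y) * B x y - Real.exp (Z' x y) * B x y| ≤ 4 * D * ε := by
      intro Z Z' hZ hZ' x y
      by_cases hb : B x y = 0
      · rw [hb, mul_zero, mul_zero, sub_zero, abs_zero]; positivity
      · rw [← sub_mul, abs_mul, abs_of_nonneg (hB x y)]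
        have := mul_le_mul (abs_exp_sub_exp_le hε1 (hZ x y hb) (hZ' x y hb)) (hBD x y) (hB x y)
          (by positivity)
        linarith
    have hmid : ∀ x y, |Real.exp ((ε * X x y + ε * Y x y) / 2) * B x y -
        (Real.exp (ε * X x y) * B x y + Real.exp (ε * Y x y) * B x y) / 2| ≤ 4 * D * ε ^ 2 := by
      intro x y
      by_cases hb : B x y = 0
      · simp only [hb, mul_zero, add_zero, zero_div, sub_zero, abs_zero]; positivity
      · have e : Real.exp ((ε * X x y + ε * Y x y) / 2) * B x y -
            (Real.exp (ε * X x y) * B x y + Real.exp (ε * Y x y) * B x y) / 2 =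
            (Real.exp ((ε * X x y + ε * Y x y) / 2) -
              (Real.exp (ε * X x y) + Real.exp (ε * Y x y)) / 2) * B x y := by ring
        rw [e, abs_mul, abs_of_nonneg (hB x y)]
        have h1 := mul_le_mul (abs_exp_midpoint_sub_le hε1 (hX' x y hb) (hY' x y hb)) (hBD x y)
          (hB x y) (by positivity)
        have h2 : 0 ≤ D * ε ^ 2 := by positivity
        linarith
    have hall := hpert ε (fun x y => Real.exp (ε * X x y) * B x y)
      (fun x y => Real.exp (ε * Y x y) * B x y)
      (fun x y => Real.exp ((ε * X x y + ε * Y x y) / 2) * B x y) p h r l Λ hε hεε₀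
      (hnn fun x y => ε * Y x y)
      (fun x y => (hup (fun x y => ε * Y x y) hY' x y).trans hexp1)
      (fun x y h1 h2 => hexpm1.trans (hlow (fun x y => ε * Y x y) hY' x y h1 h2))
      (hnn fun x y => (ε * X x y + ε * Y x y) / 2)
      (fun x y => (hup (fun x y => (ε * X x y + ε * Y x y) / 2) hZ' x y).trans hexp1)
      (fun x y h1 h2 => hexpm1.trans
        (hlow (fun x y => (ε * X x y + ε * Y x y) / 2) hZ' x y h1 h2))
      (hdiff (fun x y => ε * Y x y) (fun x y => ε * X x y) hY' hX')
      (hdiff (fun x y => (ε * X x y + ε * Y x y) / 2) (fun x y => ε * X x y) hZ' hX')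
      (hdiff (fun x y => (ε * X x y + ε * Y x y) / 2) (fun x y => ε * Y x y) hZ' hY')
      hmid hp hp1 hh1 hr1 hl hh hr hlT
    refine (abs_entropyGap_le hstar hC.le hε hε1 hCε hp hp1 hps hh1 hr1 (fun x => (hall x).1)
      (fun x => (hall x).2.1) fun x => (hall x).2.2).trans ?_
    refine mul_le_mul_of_nonneg_right ?_ (by positivity)
    have : 0 ≤ 2 * (N * (Real.log k₁ + 2)) / ε₁ ^ 3 := by positivity
    linarith
  · have hk₁pos : 0 < k₁ := by linarith
    have hBc1 : 1 ≤ k₁ * Real.exp (2 * ε) :=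
      one_le_mul_of_one_le_of_one_le hk₁1 (Real.one_le_exp (by linarith))
    have hg : 0 < Real.exp (-ε) * (Real.exp (-K) * m₀) := by positivity
    have hrow : ∀ (Z : S → S → ℝ), (∀ x y, B x y ≠ 0 → |Z x y| ≤ ε) →
        ∀ x, ∑ y, Real.exp (Z x y) * B x y ≤ Fintype.card S * (Real.exp ε * D) := by
      intro Z hZ x
      refine (le_abs_self _).trans (abs_sum_le_card_mul fun y => ?_)
      rw [abs_of_nonneg (hnn Z x y)]
      exact hup Z hZ x y
    have hratio : 2 * (Fintype.card S * (Real.exp ε * D)) / (Real.exp (-ε) * (Real.exp (-K) * m₀)) ≤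
        k₁ * Real.exp (2 * ε) := by
      have e : 2 * (Fintype.card S * (Real.exp ε * D)) /
          (Real.exp (-ε) * (Real.exp (-K) * m₀)) = (k₁ - 1) * Real.exp (2 * ε) := by
        rw [hk₁, Real.exp_neg ε, two_mul ε, Real.exp_add]
        field_simp
        ring
      rw [e]
      exact mul_le_mul_of_nonneg_right (by linarith) (Real.exp_pos _).le
    have hlamnn : ∀ x, 0 ≤ ∑ y, Real.exp (ε * X x y) * B x y := fun x =>
      Finset.sum_nonneg fun y _ => hnn (fun x y => ε * X x y) x y
    have hharn : ∀ (Z : S → S → ℝ) (v : S → ℝ) (Λ : ℝ), (∀ x y, B x y ≠ 0 → |Z x y| ≤ ε) →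
        (∀ x, 0 < v x) → (∑ x, p x * v x = 1) →
        (∀ x, ∑ y, Real.exp (Z x y) * B x y * v y -
          (∑ y, Real.exp (ε * X x y) * B x y) * v x = Λ * v x) →
        ∀ x, |Real.log (v x)| ≤ N * Real.log (k₁ * Real.exp (2 * ε)) := by
      intro Z v Λ hZ hv hv1 he
      refine abs_log_le_of_harnack hp hp1 hv1 (by linarith) hv
        (hN (k₁ * Real.exp (2 * ε)) v hBc1 hv fun x y h1 h2 => ?_)
      exact (harnack_eigenvector (hnn Z) hv hlamnn (hrow (fun x y => ε * X x y) hX') (hrow Z hZ) hg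
        he (hlow Z hZ x y h1 h2)).trans (mul_le_mul_of_nonneg_right hratio (hv x).le)
    have hlogB : Real.log (k₁ * Real.exp (2 * ε)) = Real.log k₁ + 2 * ε := by
      rw [Real.log_mul hk₁pos.ne' (Real.exp_pos _).ne', Real.log_exp]
    -- The same Harnack bound serves h, which satisfies its eigenvalue equation with Λ = 0.
    refine (abs_entropyGap_le_of_log hstar hp hps hh1 hh0 hr0
      (hharn (fun x y => ε * Y x y) h 0 hY' hh0 hh1 fun x => by rw [hh, sub_self, zero_mul])
      (hharn (fun x y => (ε * X x y + ε * Y x y) / 2) r Λ hZ' hr0 hr1 hr)).trans ?_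
    rw [hlogB]
    have hε₁1 : ε₁ ≤ 1 := (hε₁ ▸ min_le_left _ _ : ε₁ ≤ ε₀).trans hε₀1
    have hq : 1 ≤ ε / ε₁ := (one_le_div hε₁0).2 hge
    have hq3 : 1 ≤ ε ^ 3 / ε₁ ^ 3 := by
      rw [← div_pow]
      exact one_le_pow₀ hq
    have hq1 : ε ≤ ε ^ 3 / ε₁ ^ 3 := by
      rw [← div_pow]
      calc ε ≤ ε / ε₁ := le_div_self hε hε₁0 hε₁1
        _ ≤ (ε / ε₁) ^ 3 := le_self_pow₀ hq (by norm_num)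
    -- Both 1 and ε are at most (ε / ε₁)³, so the linear bound is dominated by a cubic one.
    have h1 : Real.log k₁ + 2 * ε ≤ (Real.log k₁ + 2) * (ε ^ 3 / ε₁ ^ 3) := by
      nlinarith [mul_le_mul_of_nonneg_left hq3 hlogk₁]
    have h2 := mul_le_mul_of_nonneg_left h1 (by positivity : (0 : ℝ) ≤ 2 * N)
    have h3 : 0 ≤ (4 * C ^ 3 + 2 * C ^ 4 + C ^ 2) * ε ^ 3 := by positivity
    calc _ = 2 * N * (Real.log k₁ + 2 * ε) := by ring
      _ ≤ 2 * N * ((Real.log k₁ + 2) * (ε ^ 3 / ε₁ ^ 3)) := h2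
      _ = 2 * (N * (Real.log k₁ + 2)) / ε₁ ^ 3 * ε ^ 3 := by ring
      _ ≤ _ := by rw [add_mul]; linarith

end EntropyGap

/-! ### Uniqueness of invariant vectors, Perron asymptotics and the entropy identity -/

section Invariant

variable {S : Type*} [Fintype S]

/-- The Dirichlet form of the density p / ρ vanishes when both vectors are invariant, so the density
is constant. No sign condition on p is needed. -/
theorem eq_of_invariant {B : S → S → ℝ} {ρ p : S → ℝ} (hB : ∀ x y, 0 ≤ B x y)
    (hirr : ∀ x y, Relation.ReflTransGen (fun a b => 0 < B a b) x y)
    (hρ : ∀ x, 0 < ρ x) (hρ1 : ∑ x, ρ x = 1) (hp1 : ∑ x, p x = 1)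
    (hρi : ∀ y, ∑ x, ρ x * B x y = ρ y * ∑ x, B y x)
    (hpi : ∀ y, ∑ x, p x * B x y = p y * ∑ x, B y x) : p = ρ := by
  obtain ⟨C, hC, h⟩ := exists_sq_sub_le_dirichlet hB hρ hirr
  obtain ⟨g, hg⟩ : ∃ g : S → ℝ, ∀ x, p x = ρ x * g x :=
    ⟨fun x => p x / ρ x, fun x => by rw [mul_div_cancel₀ _ (hρ x).ne']⟩
  have hD : ∑ x, ∑ y, ρ x * B x y * (g x - g y) ^ 2 = 0 := by
    have e : ∀ x y, ρ x * B x y * (g x - g y) ^ 2 =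
        p x * g x * B x y + (ρ x * B x y) * g y ^ 2 - 2 * (p x * B x y * g y) := fun x y => by
      rw [hg]; ring
    simp only [e, Finset.sum_sub_distrib, Finset.sum_add_distrib]
    rw [Finset.sum_comm (f := fun x y => ρ x * B x y * g y ^ 2),
      Finset.sum_comm (f := fun x y => 2 * (p x * B x y * g y))]
    simp only [← Finset.sum_mul, ← Finset.mul_sum, hρi, hpi]
    rw [← Finset.sum_add_distrib, Finset.mul_sum, ← Finset.sum_sub_distrib]
    refine Finset.sum_eq_zero fun x _ => ?_
    rw [hg]
    ring
  have hconst : ∀ x y, g x = g y := fun x y => by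
    have := h g x y
    rw [hD, mul_zero] at this
    exact sub_eq_zero.1 (pow_eq_zero_iff two_ne_zero |>.1 (le_antisymm this (sq_nonneg _)))
  funext x
  have : g x = 1 := by
    rw [← hp1, ← mul_one (g x), ← hρ1, Finset.mul_sum]
    exact Finset.sum_congr rfl fun y _ => by rw [hg, hconst x y, mul_comm]
  rw [hg, this, mul_one]

/-- Doob transform: exp(-Λt) V / r solves the backward equation of the jump process with rates T x y
r y / r x, whose stationary distribution is proportional to l r. Relaxation to its mean gives the
limit. -/
theorem tendsto_flow {T : S → S → ℝ} {lam r l : S → ℝ} {Λ : ℝ} {V : ℝ → S → ℝ} [Nonempty S]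
    (hT : ∀ x y, 0 ≤ T x y) (hirr : ∀ x y, Relation.ReflTransGen (fun a b => 0 < T a b) x y)
    (hr : ∀ x, 0 < r x) (hl : ∀ x, 0 < l x)
    (her : ∀ x, ∑ y, T x y * r y - lam x * r x = Λ * r x)
    (hel : ∀ y, ∑ x, l x * T x y - lam y * l y = Λ * l y)
    (hV : ∀ t x, HasDerivAt (fun t => V t x) (∑ y, T x y * V t y - lam x * V t x) t) (x : S) :
    Filter.Tendsto (fun t => Real.exp (-(Λ * t)) * V t x) Filter.atTop
      (nhds (r x * ((∑ y, l y * V 0 y) / ∑ y, l y * r y))) := by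
  have hZ : 0 < ∑ y, l y * r y :=
    Finset.sum_pos (fun y _ => mul_pos (hl y) (hr y)) Finset.univ_nonempty
  have h := tendsto_of_hasDerivAt_generator (B := fun x y => T x y * r y / r x)
    (p := fun x => l x * r x / ∑ y, l y * r y)
    (f := fun t x => Real.exp (-(Λ * t)) * V t x / r x)
    (fun x y => div_nonneg (mul_nonneg (hT x y) (hr y).le) (hr x).le)
    (fun x => div_pos (mul_pos (hl x) (hr x)) hZ)
    (by rw [← Finset.sum_div, div_self hZ.ne'])
    (fun x y => Relation.ReflTransGen.mono (fun a b (hab : 0 < T a b) =>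
      div_pos (mul_pos hab (hr b)) (hr a)) x y (hirr x y))
    (fun y => by
      have e1 : ∑ x, l x * r x / (∑ y, l y * r y) * (T x y * r y / r x) =
          (∑ x, l x * T x y) * (r y / ∑ y, l y * r y) := by
        rw [Finset.sum_mul]
        refine Finset.sum_congr rfl fun x _ => ?_
        have := (hr x).ne'
        field_simp
      have e2 : ∑ x, T y x * r x / r y = Λ + lam y := by
        rw [← Finset.sum_div, div_eq_iff (hr y).ne']
        linarith [her y]
      have e3 : ∑ x, l x * T x y = (Λ + lam y) * l y := by linarith [hel y]
      rw [e1, e2, e3]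
      ring)
    (fun t x => by
      have h1 : HasDerivAt (fun t => Real.exp (-(Λ * t))) (Real.exp (-(Λ * t)) * -Λ) t := by
        have h2 : HasDerivAt (fun t => -(Λ * t)) (-Λ) t := by
          simpa using ((hasDerivAt_id t).const_mul (-Λ))
        exact h2.exp
      convert! (h1.mul (hV t x)).div_const (r x) using 1
      have hx := (hr x).ne'
      have e : ∀ y, T x y * r y / r x *
          (Real.exp (-(Λ * t)) * V t y / r y - Real.exp (-(Λ * t)) * V t x / r x) =
          Real.exp (-(Λ * t)) / r x * (T x y * V t y) -
            T x y * r y * (Real.exp (-(Λ * t)) * V t x / r x / r x) := fun y => by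
        have := (hr y).ne'
        field_simp
      simp only [e, Finset.sum_sub_distrib]
      rw [← Finset.mul_sum, ← Finset.sum_mul]
      have e3 : ∑ y, T x y * r y = (Λ + lam x) * r x := by linarith [her x]
      rw [e3]
      field_simp
      ring) x
  have h2 := h.const_mul (r x)
  have hx := (hr x).ne'
  refine (h2.congr fun t => ?_).trans (le_of_eq ?_)
  · field_simp
  · congr 2
    rw [Finset.sum_div]
    refine Finset.sum_congr rfl fun y _ => ?_
    have := (hr y).ne'
    simp only [mul_zero, neg_zero, Real.exp_zero, one_mul]
    field_simp

theorem entropy_sub_symEntropy_eq [Nonempty S] {star : S → S} (hstar : Function.Involutive star)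
    {β : ℝ} (hβ : 0 < β) {H ρ r h : S → ℝ} (hH : ∀ x, H (star x) = H x)
    (hρ : ∀ x, 0 < ρ x) (hρ1 : ∑ x, ρ x = 1) (hr : ∀ x, 0 < r x)
    (hr1 : ∑ x, Real.exp (-β * H x) / (∑ y, Real.exp (-β * H y)) * r x = 1)
    (hh : ∀ x, h x = ρ (star x) / (Real.exp (-β * H x) / ∑ y, Real.exp (-β * H y))) :
    entropy β H ρ (-(Real.log ((∑ x, Real.exp (-β * H x) * r x) / ∑ x, ρ x * r x)) / β) -
      symEntropy star ρ =
        entropyGap star (fun x => Real.exp (-β * H x) / ∑ y, Real.exp (-β * H y)) h r := by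
  obtain ⟨W, hW⟩ : ∃ W, W = ∑ y, Real.exp (-β * H y) := ⟨_, rfl⟩
  have hW0 : 0 < W := by
    rw [hW]
    exact Finset.sum_pos (fun x _ => Real.exp_pos _) Finset.univ_nonempty
  rw [← hW] at hr1 ⊢
  simp only [← hW] at hh
  have hρr : 0 < ∑ x, ρ x * r x :=
    Finset.sum_pos (fun x _ => mul_pos (hρ x) (hr x)) Finset.univ_nonempty
  -- The normalisation of r against the Gibbs distribution makes the numerator of exp(-βF) equal to
  -- the partition sum W.
  have hwr : ∑ x, Real.exp (-β * H x) * r x = W := by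
    have : ∀ x, Real.exp (-β * H x) / W * r x = Real.exp (-β * H x) * r x / W := fun x => by ring
    simp only [this] at hr1
    rwa [← Finset.sum_div, div_eq_one_iff_eq hW0.ne'] at hr1
  have hρh : ∀ x, Real.exp (-β * H x) / W * h (star x) = ρ x := fun x => by
    have := Real.exp_pos (-β * H x)
    rw [hh, hstar, hH]
    field_simp
  have hlogh : ∀ x, Real.log (h x) = Real.log (ρ (star x)) + β * H x + Real.log W := fun x => by
    rw [hh, Real.log_div (hρ _).ne' (div_pos (Real.exp_pos _) hW0).ne',
      Real.log_div (Real.exp_pos _).ne' hW0.ne', Real.log_exp]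
    ring
  have hsq : ∀ x, Real.log (Real.sqrt (ρ x * ρ (star x))) =
      (Real.log (ρ x) + Real.log (ρ (star x))) / 2 := fun x => by
    rw [Real.log_sqrt (mul_pos (hρ _) (hρ _)).le, Real.log_mul (hρ _).ne' (hρ _).ne']
  rw [entropy, symEntropy, entropyGap, hwr, Real.log_div hW0.ne' hρr.ne']
  simp only [hρh, hsq, hlogh, hstar _, hH]
  have e : ∀ x, ρ x * (Real.log (ρ (star x)) + β * H x + Real.log W +
      (Real.log (ρ x) + β * H x + Real.log W)) =
      2 * (ρ x * ((Real.log (ρ x) + Real.log (ρ (star x))) / 2)) + 2 * β * (H x * ρ x) +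
        2 * Real.log W * ρ x := fun x => by ring
  simp only [e, Finset.sum_add_distrib, ← Finset.mul_sum, hρ1]
  field_simp
  ring

end Invariant

/-! ### Existence, uniqueness and positivity of the stationary distribution -/

section Stationary

variable {S : Type*} [DecidableEq S]

/-- The rates with the unused diagonal values replaced by zero. -/
def offDiag (R : S → S → ℝ) (x y : S) : ℝ := if x = y then 0 else R x y

theorem offDiag_self (R : S → S → ℝ) (x : S) : offDiag R x x = 0 := if_pos rfl

theorem offDiag_of_ne {R : S → S → ℝ} {x y : S} (h : x ≠ y) : offDiag R x y = R x y := if_neg h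

variable [Fintype S]

theorem escapeRate_eq_sum_offDiag (R : S → S → ℝ) (x : S) :
    escapeRate R x = ∑ y, offDiag R x y := by
  rw [escapeRate, ← Finset.sum_erase (f := offDiag R x) (a := x) univ (offDiag_self R x)]
  exact Finset.sum_congr rfl fun y hy => (offDiag_of_ne (Finset.ne_of_mem_erase hy).symm).symm

theorem isStationary_iff {R : S → S → ℝ} {p : S → ℝ} :
    IsStationary R p ↔ (∀ x, 0 ≤ p x) ∧ ∑ x, p x = 1 ∧
      ∀ y, ∑ x, p x * offDiag R x y = p y * ∑ x, offDiag R y x := by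
  have key : ∀ y, -escapeRate R y * p y + ∑ x ∈ Finset.univ.erase y, p x * R x y =
      ∑ x, p x * offDiag R x y - p y * ∑ x, offDiag R y x := by
    intro y
    have h : ∑ x ∈ Finset.univ.erase y, p x * R x y = ∑ x, p x * offDiag R x y := by
      rw [← Finset.sum_erase (f := fun x => p x * offDiag R x y) (a := y) univ
        (by rw [offDiag_self, mul_zero])]
      exact Finset.sum_congr rfl fun x hx => by rw [offDiag_of_ne (Finset.ne_of_mem_erase hx)]
    rw [h, escapeRate_eq_sum_offDiag]
    ring
  constructor
  · rintro ⟨h1, h2, h3⟩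
    exact ⟨h1, h2, fun y => sub_eq_zero.1 (by rw [← key, h3])⟩
  · rintro ⟨h1, h2, h3⟩
    exact ⟨h1, h2, fun y => by rw [key, h3, sub_self]⟩

theorem exists_unique_stationary [Nonempty S] {R : S → S → ℝ} (hR : ∀ x y, 0 ≤ offDiag R x y)
    (hirr : ∀ x y, Relation.ReflTransGen (fun a b => 0 < offDiag R a b) x y) :
    ∃ ρ : S → ℝ, (∀ p, IsStationary R p ↔ p = ρ) ∧ ∀ x, 0 < ρ x := by
  obtain ⟨μ, q, hq, h⟩ := exists_pos_eigenvector_of_offDiag (B := fun x y => offDiag R y x)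
    (fun x y => hR y x) (fun x => ∑ y, offDiag R x y)
    (fun x y => Relation.reflTransGen_swap.1 (hirr y x))
  have hQ : 0 < ∑ x, q x := Finset.sum_pos (fun x _ => hq x) Finset.univ_nonempty
  -- Summing the eigenvalue equation over all states gives zero on the left by conservation of
  -- probability.
  have hμ : μ = 0 := by
    have h0 : μ * ∑ x, q x = 0 := by
      rw [Finset.mul_sum, ← Finset.sum_congr rfl fun x _ => h x, Finset.sum_sub_distrib,
        Finset.sum_comm, sub_eq_zero]
      exact Finset.sum_congr rfl fun x _ => by rw [Finset.sum_mul]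
    exact (mul_eq_zero.1 h0).resolve_right hQ.ne'
  have hinv : ∀ y, ∑ x, (q x / ∑ x, q x) * offDiag R x y =
      (q y / ∑ x, q x) * ∑ x, offDiag R y x := by
    intro y
    have := h y
    rw [hμ, zero_mul, sub_eq_zero] at this
    rw [div_mul_eq_mul_div, mul_comm (q y), ← this, Finset.sum_div]
    exact Finset.sum_congr rfl fun x _ => by ring
  have hpos : ∀ x, 0 < q x / ∑ x, q x := fun x => div_pos (hq x) hQ
  have hsum : ∑ x, q x / ∑ x, q x = 1 := by rw [← Finset.sum_div, div_self hQ.ne']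
  refine ⟨fun x => q x / ∑ x, q x, fun p => ⟨fun hp => ?_, ?_⟩, hpos⟩
  · rw [isStationary_iff] at hp
    exact eq_of_invariant hR hirr hpos hsum hp.2.1 hinv hp.2.2
  · rintro rfl
    exact isStationary_iff.2 ⟨fun x => (hpos x).le, hsum, hinv⟩

end Stationary

/-! ### The limit that defines the free energy -/

section FreeEnergy

variable {S : Type*} [Fintype S] [DecidableEq S]

theorem exists_backward_flow (T : S → S → ℝ) (lam γ : S → ℝ) :
    ∃ V : ℝ → S → ℝ, V 0 = γ ∧
      ∀ t x, HasDerivAt (fun t => V t x) (∑ y, T x y * V t y - lam x * V t x) t := by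
  obtain ⟨V, h0, hV⟩ := exists_linear_flow
    (Matrix.of fun x y => T x y - if x = y then lam x else 0) γ
  refine ⟨V, h0, fun t x => ?_⟩
  convert! hV t x using 1
  simp [sub_mul]

/-- The weight exp(-½ ∑ g) factorises over jumps and is absorbed into T. The path expansion runs
backwards from b, so the flow is evaluated at b - s. -/
theorem pathIntegral_eq_flow {R T : S → S → ℝ} {φ : S → ℝ} {V : ℝ → S → ℝ} {g : S → S → ℝ}
    (hR : ∀ x y, 0 ≤ offDiag R x y) (hT : ∀ x y, 0 ≤ T x y) (hTd : ∀ x, T x x = 0)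
    (hg : ∀ x y, x ≠ y → Real.exp (-(g x y) / 2) * R x y = T x y) (hγ : ∀ x, 0 ≤ V 0 x)
    (hV : ∀ t x, HasDerivAt (fun t => V t x) (∑ y, T x y * V t y - escapeRate R x * V t x) t)
    {a b : ℝ} (hab : a ≤ b) :
    pathIntegral a b (fun w => φ w.first * V 0 w.last *
      (Real.exp (-(w.sumJumps g) / 2) * w.weight R a b)) = ∑ z, φ z * V (b - a) z := by
  have hlam : ∀ x, 0 ≤ escapeRate R x := fun x => by
    rw [escapeRate_eq_sum_offDiag]
    exact Finset.sum_nonneg fun y _ => hR x y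
  refine pathIntegral_eq (B := T) (lam := escapeRate R) (V := fun s => V (b - s)) hT hTd hlam
    (by simpa using hγ) (fun s x => ?_) hab fun w hw => ?_
  · have h1 : HasDerivAt (fun s => b - s) (-1) s := by
      simpa using (hasDerivAt_id s).const_sub b
    convert! (hV (b - s) x).comp s h1 using 1
    ring
  · have h : Real.exp (-(w.sumJumps g) / 2) *
        ∏ j : Fin w.n, R (w.state j.castSucc) (w.state j.succ) =
          ∏ j : Fin w.n, T (w.state j.castSucc) (w.state j.succ) := by
      rw [JumpPath.sumJumps, ← Finset.sum_neg_distrib, Finset.sum_div, Real.exp_sum,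
        ← Finset.prod_mul_distrib]
      exact Finset.prod_congr rfl fun j _ => hg _ _ (hw j)
    rw [JumpPath.weight, ← mul_assoc (Real.exp _), h]
    simp only [sub_self]
    ring

/-- With Z = ∑ w(y) r(y*) r(y), the numerator grows as exp(Λτ/2) r(x) ∑ w r / Z and the denominator
as exp(Λτ/2) w(x) r(x) ∑ ρ r / Z. Multiplying the quotient by w(x) removes the dependence on x. -/
theorem isFreeEnergy_of_eigenvector [Nonempty S] {star : S → S} (hstar : Function.Involutive star)
    {β : ℝ} (hβ : 0 < β) {H : S → ℝ} (hH : ∀ x, H (star x) = H x) {R T : S → S → ℝ} {ρ r : S → ℝ}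
    {Λ : ℝ} (hR : ∀ x y, 0 ≤ offDiag R x y) (hT : ∀ x y, 0 ≤ T x y) (hTd : ∀ x, T x x = 0)
    (hg : ∀ x y, x ≠ y → Real.exp (-(neqEntropyProd star β H R x y) / 2) * R x y = T x y)
    (hirr : ∀ x y, Relation.ReflTransGen (fun a b => 0 < T a b) x y)
    (hρ : ∀ x, 0 < ρ x) (hr : ∀ x, 0 < r x)
    (her : ∀ x, ∑ y, T x y * r y - escapeRate R x * r x = Λ * r x)
    (hel : ∀ y, ∑ x, Real.exp (-β * H x) * r (star x) * T x y -
      escapeRate R y * (Real.exp (-β * H y) * r (star y)) =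
        Λ * (Real.exp (-β * H y) * r (star y))) :
    IsFreeEnergy star β H R ρ
      (-(Real.log ((∑ x, Real.exp (-β * H x) * r x) / ∑ x, ρ x * r x)) / β) := by
  have hw : 0 < ∑ x, Real.exp (-β * H x) * r x :=
    Finset.sum_pos (fun x _ => mul_pos (Real.exp_pos _) (hr x)) Finset.univ_nonempty
  have hρr : 0 < ∑ x, ρ x * r x :=
    Finset.sum_pos (fun x _ => mul_pos (hρ x) (hr x)) Finset.univ_nonempty
  have hl : ∀ x, 0 < Real.exp (-β * H x) * r (star x) := fun x => mul_pos (Real.exp_pos _) (hr _)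
  have hZ : 0 < ∑ y, Real.exp (-β * H y) * r (star y) * r y :=
    Finset.sum_pos (fun y _ => mul_pos (hl y) (hr y)) Finset.univ_nonempty
  intro x
  have hexp : Real.exp (-β * (-(Real.log ((∑ x, Real.exp (-β * H x) * r x) / ∑ x, ρ x * r x)) / β)) =
      (∑ x, Real.exp (-β * H x) * r x) / ∑ x, ρ x * r x := by
    rw [neg_mul, neg_div, mul_neg, neg_neg, mul_div_cancel₀ _ hβ.ne', Real.exp_log (div_pos hw hρr)]
  rw [hexp]
  -- The numerator leaves the final state free, so V starts from 1; the denominator prescribes the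
  -- final state x*, so W starts from its indicator.
  obtain ⟨V, hV0, hV⟩ := exists_backward_flow T (escapeRate R) (fun _ => 1)
  obtain ⟨W, hW0, hW⟩ := exists_backward_flow T (escapeRate R) (Pi.single (star x) 1)
  have hnum : ∀ τ : ℝ, 0 ≤ τ →
      expFrom R (-τ) (-τ / 2) x (expNegHalfPsi star β H R) = V (τ / 2) x := by
    intro τ hτ
    have h := pathIntegral_eq_flow (φ := Pi.single x 1) hR hT hTd hg
      (fun y => by rw [hV0]; exact zero_le_one) hV (a := -τ) (b := -τ / 2) (by linarith)
    have e : -τ / 2 - -τ = τ / 2 := by ring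
    rw [e] at h
    rw [expFrom]
    simp only [Pi.single_apply, ite_mul, one_mul, zero_mul, Finset.sum_ite_eq', Finset.mem_univ,
      if_true, hV0] at h
    exact h
  have hden : ∀ τ : ℝ, 0 ≤ τ →
      expTo R ρ (τ / 2) τ (star x) (expNegHalfPsi star β H R) = ∑ z, ρ z * W (τ / 2) z := by
    intro τ hτ
    have h := pathIntegral_eq_flow (φ := ρ) hR hT hTd hg
      (fun y => by rw [hW0, Pi.single_apply]; split_ifs <;> norm_num) hW
      (a := τ / 2) (b := τ) (by linarith)
    have e : τ - τ / 2 = τ / 2 := by ring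
    rw [e] at h
    rw [expTo, ← h]
    congr 1
    funext w
    simp only [hW0, Pi.single_apply, expNegHalfPsi]
    split_ifs <;> ring
  have hhalf : Filter.Tendsto (fun τ : ℝ => τ / 2) Filter.atTop Filter.atTop :=
    Filter.tendsto_id.atTop_div_const two_pos
  have hVlim := (tendsto_flow hT hirr hr hl her hel hV x).comp hhalf
  have hWlim := (tendsto_finsetSum Finset.univ fun z _ =>
    (tendsto_flow hT hirr hr hl her hel hW z).const_mul (ρ z)).comp hhalf
  have hsumV : ∑ y, Real.exp (-β * H y) * r (star y) * V 0 y = ∑ y, Real.exp (-β * H y) * r y := by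
    rw [hV0, ← Equiv.sum_comp (hstar.toPerm star)]
    exact Finset.sum_congr rfl fun y _ => by
      simp [hH, hstar y]
  have hsumW : ∑ y, Real.exp (-β * H y) * r (star y) * W 0 y = Real.exp (-β * H x) * r x := by
    rw [hW0]
    simp [Pi.single_apply, hH, hstar x]
  rw [hsumV] at hVlim
  simp only [hsumW, ← mul_assoc (ρ _)] at hWlim
  rw [← Finset.sum_mul] at hWlim
  have hne : (∑ z, ρ z * r z) * (Real.exp (-β * H x) * r x /
      ∑ y, Real.exp (-β * H y) * r (star y) * r y) ≠ 0 :=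
    (mul_pos hρr (div_pos (mul_pos (Real.exp_pos _) (hr x)) hZ)).ne'
  have hlim := ((hVlim.div hWlim hne).const_mul (Real.exp (-β * H x)))
  refine (hlim.congr' ?_).trans (le_of_eq ?_)
  · refine Filter.eventually_atTop.2 ⟨0, fun τ hτ => ?_⟩
    simp only [Pi.div_apply, Function.comp_apply, mul_assoc, mul_left_comm (ρ _)]
    rw [hnum τ hτ, hden τ hτ, ← Finset.mul_sum, mul_div_mul_left _ _ (Real.exp_pos _).ne']
  · congr 1
    have h1 := (hr x).ne'
    have h2 := (Real.exp_pos (-β * H x)).ne'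
    have h3 := hZ.ne'
    have h4 := hρr.ne'
    generalize (∑ y, Real.exp (-β * H y) * r (star y) * r y) = Z at h3 ⊢
    generalize (∑ y, Real.exp (-β * H y) * r y) = A
    generalize Real.exp (-β * H x) = e at h2 ⊢
    field_simp

end FreeEnergy

/-! ### Detailed balance and the tilted rates of a model -/

namespace Model

variable {S : Type*} [Fintype S] [DecidableEq S] {star : S → S} {β : ℝ} {c : S → S → ℝ} {E K : ℝ}
  {N P : Type*}

theorem exp_mul_rateEq (M : Model star β c E K N P) (ν : N) {x y : S} (hxy : x ≠ y) :
    Real.exp (-β * M.H ν x) * M.rateEq ν x y =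
      Real.exp (-β * M.H ν y) * M.rateEq ν (star y) (star x) := by
  rw [M.detailed_balance ν x y hxy, M.H_star]

theorem rateEq_nonneg (M : Model star β c E K N P) (hc : ∀ x y, x ≠ y → 0 ≤ c x y) (ν : N) {x y : S}
    (hxy : x ≠ y) : 0 ≤ M.rateEq ν x y :=
  (mul_nonneg (Real.exp_pos _).le (hc x y hxy)).trans (M.rateEq_lower ν x y hxy)

theorem c_ne_zero (M : Model star β c E K N P) (ν : N) {x y : S} (hxy : x ≠ y)
    (h : 0 < M.rateEq ν x y) : c x y ≠ 0 := fun h0 => by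
  have := M.rateEq_upper ν x y hxy
  rw [h0, mul_zero] at this
  linarith

theorem rateEq_star_pos (M : Model star β c E K N P) (ν : N) {x y : S} (hxy : x ≠ y)
    (h : 0 < M.rateEq ν x y) : 0 < M.rateEq ν (star y) (star x) := by
  have h1 := mul_pos (Real.exp_pos (-β * M.H ν x)) h
  rw [M.exp_mul_rateEq ν hxy] at h1
  exact pos_of_mul_pos_right h1 (Real.exp_pos _).le

/-- Weighting with `exp (-Ψ / 2)` replaces the rates by geometric means. -/
theorem exp_neqEntropyProd_mul_rate (M : Model star β c E K N P)
    (hc : ∀ x y, x ≠ y → 0 ≤ c x y) (ε : ℝ) (ν : N) (κ : P) {x y : S} (hxy : x ≠ y) :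
    Real.exp (-(neqEntropyProd star β (M.H ν) (M.rate ε ν κ) x y) / 2) * M.rate ε ν κ x y =
      Real.exp ((ε * M.xi κ x y + ε * M.xi κ (star y) (star x)) / 2) * M.rateEq ν x y := by
  rcases (M.rateEq_nonneg hc ν hxy).eq_or_lt with h0 | hpos
  · simp [Model.rate, ← h0]
  · have hpos' := M.rateEq_star_pos ν hxy hpos
    have hlog := congrArg Real.log (M.exp_mul_rateEq ν hxy)
    rw [Real.log_mul (Real.exp_pos _).ne' hpos.ne', Real.log_mul (Real.exp_pos _).ne' hpos'.ne',
      Real.log_exp, Real.log_exp] at hlog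
    -- Detailed balance cancels the energy difference, and only the antisymmetric part of the
    -- driving survives in ψ.
    have h : neqEntropyProd star β (M.H ν) (M.rate ε ν κ) x y =
        ε * M.xi κ x y - ε * M.xi κ (star y) (star x) := by
      rw [neqEntropyProd, entropyProd, Model.rate, Model.rate,
        Real.log_div (mul_pos (Real.exp_pos _) hpos).ne' (mul_pos (Real.exp_pos _) hpos').ne',
        Real.log_mul (Real.exp_pos _).ne' hpos.ne', Real.log_mul (Real.exp_pos _).ne' hpos'.ne',
        Real.log_exp, Real.log_exp]
      linarith
    rw [h, Model.rate, ← mul_assoc, ← Real.exp_add]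
    congr 2
    ring

end Model
end NESS

/-! ### Assembly of the theorem -/

theorem mainTheorem9 {S : Type*} [Fintype S] [DecidableEq S] [Nonempty S]
    (star : S → S) (hstar : Function.Involutive star)
    (β : ℝ) (hβ : 0 < β)
    (c : S → S → ℝ) (hc : ∀ x y, x ≠ y → 0 ≤ c x y) (hconn : NESS.IsConnected c)
    (E K : ℝ) :
    ∃ A' : ℝ, 0 < A' ∧
      ∀ {N P : Type*} (M : NESS.Model star β c E K N P) (ε : ℝ) (ν : N) (κ : P), 0 ≤ ε →
        (∀ x, NESS.escapeRate (M.rate ε ν κ) (star x) = NESS.escapeRate (M.rate ε ν κ) x) →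
        ∃ (ρ : S → ℝ) (F : ℝ),
          (∀ p, NESS.IsStationary (M.rate ε ν κ) p ↔ p = ρ) ∧
          (∀ x, 0 < ρ x) ∧
          NESS.IsFreeEnergy star β (M.H ν) (M.rate ε ν κ) ρ F ∧
          |NESS.entropy β (M.H ν) ρ F - NESS.symEntropy star ρ| ≤ A' * ε ^ 3 := by
  open NESS in
  obtain ⟨A', hA', hgap⟩ := exists_entropyGap_bound hstar hc hconn K
  refine ⟨A', hA', ?_⟩
  intro N P M ε ν κ hε hesc
  have hsne : ∀ {x y : S}, x ≠ y → star y ≠ star x := fun h h' => h (hstar.injective h').symm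
  obtain ⟨B, hB⟩ : ∃ B : S → S → ℝ, B = offDiag (M.rateEq ν) := ⟨_, rfl⟩
  have hBd : ∀ x, B x x = 0 := fun x => by rw [hB, offDiag_self]
  have hBne : ∀ {x y}, x ≠ y → B x y = M.rateEq ν x y := fun h => by rw [hB, offDiag_of_ne h]
  have hB0 : ∀ x y, 0 ≤ B x y := fun x y => by
    by_cases h : x = y
    · rw [h, hBd]
    · rw [hBne h]; exact M.rateEq_nonneg hc ν h
  have hBpos : ∀ {x y}, B x y ≠ 0 → x ≠ y ∧ 0 < M.rateEq ν x y := fun {x y} h => by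
    have hxy : x ≠ y := by rintro rfl; exact h (hBd _)
    exact ⟨hxy, by rw [← hBne hxy]; exact lt_of_le_of_ne (hB0 x y) h.symm⟩
  have hBstar : ∀ x y, Real.exp (-β * M.H ν x) * B x y =
      Real.exp (-β * M.H ν y) * B (star y) (star x) := fun x y => by
    by_cases h : x = y
    · rw [h, hBd, hBd, mul_zero]
    · rw [hBne h, hBne (hsne h)]; exact M.exp_mul_rateEq ν h
  have hRoff : ∀ x y, offDiag (M.rate ε ν κ) x y = Real.exp (ε * M.xi κ x y) * B x y := fun x y => by
    by_cases h : x = y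
    · rw [h, hBd, offDiag_self, mul_zero]
    · rw [offDiag_of_ne h, hBne h, Model.rate]
  have hR0 : ∀ x y, 0 ≤ offDiag (M.rate ε ν κ) x y := fun x y => by
    rw [hRoff]; exact mul_nonneg (Real.exp_pos _).le (hB0 x y)
  have hBirr : ∀ x y, Relation.ReflTransGen (fun a b => 0 < B a b) x y := fun x y =>
    Relation.ReflTransGen.mono (fun a b (hab : a ≠ b ∧ c a b ≠ 0) => by
      rw [hBne hab.1]
      exact (mul_pos (Real.exp_pos _) (lt_of_le_of_ne (hc a b hab.1) hab.2.symm)).trans_le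
        (M.rateEq_lower ν a b hab.1)) x y (hconn x y)
  have hRirr : ∀ x y, Relation.ReflTransGen (fun a b => 0 < offDiag (M.rate ε ν κ) a b) x y :=
    fun x y => Relation.ReflTransGen.mono (fun a b (hab : 0 < B a b) => by
      rw [hRoff]; exact mul_pos (Real.exp_pos _) hab) x y (hBirr x y)
  have hlam : ∀ x, escapeRate (M.rate ε ν κ) x = ∑ y, Real.exp (ε * M.xi κ x y) * B x y :=
    fun x => by simp only [escapeRate_eq_sum_offDiag, hRoff]
  obtain ⟨ρ, hρu, hρ⟩ := exists_unique_stationary hR0 hRirr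
  obtain ⟨-, hρ1, hρi⟩ := isStationary_iff.1 ((hρu ρ).2 rfl)
  obtain ⟨T, hT⟩ : ∃ T : S → S → ℝ, T = fun x y =>
    Real.exp ((ε * M.xi κ x y + ε * M.xi κ (star y) (star x)) / 2) * B x y := ⟨_, rfl⟩
  have hT0 : ∀ x y, 0 ≤ T x y := fun x y => by
    rw [hT]; exact mul_nonneg (Real.exp_pos _).le (hB0 x y)
  have hTd : ∀ x, T x x = 0 := fun x => by simp [hT, hBd]
  have hTirr : ∀ x y, Relation.ReflTransGen (fun a b => 0 < T a b) x y :=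
    fun x y => Relation.ReflTransGen.mono (fun a b (hab : 0 < B a b) => by
      rw [hT]; exact mul_pos (Real.exp_pos _) hab) x y (hBirr x y)
  -- The exponent in T is unchanged under (x, y) ↦ (y*, x*), so T inherits the detailed balance of
  -- the equilibrium rates.
  have hTstar : ∀ x y, Real.exp (-β * M.H ν x) * T x y =
      Real.exp (-β * M.H ν y) * T (star y) (star x) := fun x y => by
    simp only [hT, hstar _]
    rw [mul_left_comm, hBstar, mul_left_comm, add_comm (ε * M.xi κ x y)]
  obtain ⟨Λ, r₀, hr₀, her₀⟩ := exists_pos_eigenvector_of_offDiag hT0 (escapeRate (M.rate ε ν κ)) hTirr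
  obtain ⟨W, hW⟩ : ∃ W, W = ∑ y, Real.exp (-β * M.H ν y) := ⟨_, rfl⟩
  have hW0 : 0 < W := by
    rw [hW]
    exact Finset.sum_pos (fun x _ => Real.exp_pos _) Finset.univ_nonempty
  obtain ⟨p, hp⟩ : ∃ p : S → ℝ, p = fun x => Real.exp (-β * M.H ν x) / W := ⟨_, rfl⟩
  have hp0 : ∀ x, 0 < p x := fun x => by rw [hp]; exact div_pos (Real.exp_pos _) hW0
  have hp1 : ∑ x, p x = 1 := by
    rw [hp, ← Finset.sum_div, ← hW, div_self hW0.ne']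
  have hps : ∀ x, p (star x) = p x := fun x => by simp only [hp, M.H_star]
  have hs : 0 < ∑ x, p x * r₀ x :=
    Finset.sum_pos (fun x _ => mul_pos (hp0 x) (hr₀ x)) Finset.univ_nonempty
  obtain ⟨r, hr⟩ : ∃ r : S → ℝ, r = fun x => r₀ x / ∑ x, p x * r₀ x := ⟨_, rfl⟩
  have hrpos : ∀ x, 0 < r x := fun x => by rw [hr]; exact div_pos (hr₀ x) hs
  have hr1 : ∑ x, p x * r x = 1 := by
    simp only [hr, mul_div_assoc']
    rw [← Finset.sum_div, div_self hs.ne']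
  have her : ∀ x, ∑ y, T x y * r y - escapeRate (M.rate ε ν κ) x * r x = Λ * r x := fun x => by
    simp only [hr, mul_div_assoc']
    rw [← Finset.sum_div, ← sub_div, her₀]
  -- Reversal turns the right eigenvector equation at y* into the left one at y; this uses the
  -- assumed symmetry of the escape rates.
  have hel : ∀ y, ∑ x, Real.exp (-β * M.H ν x) * r (star x) * T x y -
      escapeRate (M.rate ε ν κ) y * (Real.exp (-β * M.H ν y) * r (star y)) =
        Λ * (Real.exp (-β * M.H ν y) * r (star y)) := fun y => by
    have e : ∑ x, Real.exp (-β * M.H ν x) * r (star x) * T x y =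
        Real.exp (-β * M.H ν y) * ∑ x, T (star y) x * r x := by
      rw [← Equiv.sum_comp (hstar.toPerm star) fun x => T (star y) x * r x, Finset.mul_sum]
      refine Finset.sum_congr rfl fun x _ => ?_
      rw [mul_right_comm, hTstar, mul_assoc]
      rfl
    have h1 : ∑ x, T (star y) x * r x =
        Λ * r (star y) + escapeRate (M.rate ε ν κ) y * r (star y) := by
      rw [← hesc y]
      linarith [her (star y)]
    rw [e, h1]
    ring
  -- The reversed state in ρ(x*) turns the forward equation for ρ into a backward equation for h
  -- with rates Q, comparable with those for 1 and r.
  obtain ⟨h, hh⟩ : ∃ h : S → ℝ, h = fun x => ρ (star x) / p x := ⟨_, rfl⟩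
  have hh0 : ∀ x, 0 < h x := fun x => by rw [hh]; exact div_pos (hρ _) (hp0 x)
  have hph : ∀ x, p x * h x = ρ (star x) := fun x => by
    rw [hh]; exact mul_div_cancel₀ _ (hp0 x).ne'
  have hh1 : ∑ x, p x * h x = 1 := by
    simp only [hph]
    rw [← hρ1]
    exact Equiv.sum_comp (hstar.toPerm star) ρ
  have hhe : ∀ x, ∑ y, Real.exp (ε * M.xi κ (star y) (star x)) * B x y * h y =
      (∑ y, Real.exp (ε * M.xi κ x y) * B x y) * h x := fun x => by
    have e : ∀ y, Real.exp (ε * M.xi κ (star y) (star x)) * B x y * h y =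
        ρ (star y) * offDiag (M.rate ε ν κ) (star y) (star x) / p x := fun y => by
      rw [hRoff, eq_div_iff (hp0 x).ne', ← hph y]
      have h2 : p x * B x y = p y * B (star y) (star x) := by
        simp only [hp, div_mul_eq_mul_div, hBstar x y]
      linear_combination Real.exp (ε * M.xi κ (star y) (star x)) * h y * h2
    simp only [e]
    have e2 : ∑ y, ρ (star y) * offDiag (M.rate ε ν κ) (star y) (star x) =
        ∑ y, ρ y * offDiag (M.rate ε ν κ) y (star x) :=
      Equiv.sum_comp (hstar.toPerm star) fun y => ρ y * offDiag (M.rate ε ν κ) y (star x)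
    rw [← Finset.sum_div, e2, hρi, ← escapeRate_eq_sum_offDiag, hesc,
      ← hlam, hh]
    ring
  refine ⟨ρ, -(Real.log ((∑ x, Real.exp (-β * M.H ν x) * r x) / ∑ x, ρ x * r x)) / β, hρu, hρ, ?_, ?_⟩
  · refine isFreeEnergy_of_eigenvector hstar hβ (M.H_star ν) hR0 hT0 hTd (fun x y hxy => ?_) hTirr hρ
      hrpos her hel
    rw [M.exp_neqEntropyProd_mul_rate hc ε ν κ hxy, hT, ← hBne hxy]
  · rw [entropy_sub_symEntropy_eq hstar hβ (h := h) (M.H_star ν) hρ hρ1 hrpos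
      (by rw [← hW]; simpa only [hp] using hr1) (fun x => by rw [← hW]; simp only [hh, hp]), ← hW, ← hp]
    refine hgap ε B (M.xi κ) (fun x y => M.xi κ (star y) (star x)) p h r
      (fun x => Real.exp (-β * M.H ν x) * r (star x)) Λ hε hBd hB0
      (fun x y hxy => by rw [hBne hxy]; exact M.rateEq_lower ν x y hxy)
      (fun x y hxy => by rw [hBne hxy]; exact M.rateEq_upper ν x y hxy)
      (fun x y hb => M.xi_bound κ x y (hBpos hb).1 (M.c_ne_zero ν (hBpos hb).1 (hBpos hb).2))
      (fun x y hb => M.xi_bound κ _ _ (hsne (hBpos hb).1) (M.c_ne_zero ν (hsne (hBpos hb).1)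
        (M.rateEq_star_pos ν (hBpos hb).1 (hBpos hb).2)))
      (fun x => (hp0 x).le) hp1 hps hh1 hr1 hh0 hrpos
      (fun x => mul_pos (Real.exp_pos _) (hrpos _)) hhe (fun x => ?_) (fun y => ?_)
    · have := her x
      rw [hlam, hT] at this
      exact this
    · have := hel y
      rw [hlam, hT] at this
      exact this
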